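/- **Setting.** For an oriented hyperbolic line $X=[x,x']$ in $\mathbb H^3$ ($x\ne x'$ in $\hat{\mathbb C}$) let $R_{X,\tau}$ be the rotation about $X$ through $\tau$, $T_{X,d}$ the translation along $X$ towards $x'$ by $d$, and $H_X=R_{X,\pi}$ the half-turn; in a coordinate with $x=0$, $x'=\infty$ the map $T_{X,d}R_{X,\tau}$ is $z\mapsto e^{d+i\tau}z$, lifted to $\mathrm{diag}(e^{(d+i\tau)/2},e^{-(d+i\tau)/2})\in SL(2,\mathbb C)$. Let $A,B\in SL(2,\mathbb C)$ each fix exactly two points of $\hat{\mathbb C}$, with different axes $Ax_A\neq Ax_B$, let $L$ be the common perpendicular of $Ax_A$ and $Ax_B$, and let $L_A,L_B$ be the lines with $A=\pm H_{L_A}H_L$, $B=\pm H_{L_B}H_L$; the ends of $L_A,L,L_B$, with a chosen order for each line, are the ortho-end of the marked group $G=\langle A,B\rangle$. Let $(\mathbb P_A,\mathbb P,\mathbb P_B)$ be planes containing $L_A,L,L_B$ respectively whose horizons are pairwise disjoint or tangent circles, none of which separates the other two; each plane carries a chosen normal direction and is given by the real and complex coefficients $(\alpha,\beta,\gamma)$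 of its horizon $\alpha|z|^2+2\,\mathrm{Re}(\bar\beta z)+\gamma=0$ (the normal pointing to the side where the left-hand side is positive). The planar family consists of all marked groups $G'=\langle A',B'\rangle$ with $A'=\pm H_{L_{A'}}H_{L'}$, $B'=\pm H_{L_{B'}}H_{L'}$ for lines $L_{A'}\subset\mathbb P_A$, $L'\subset\mathbb P$, $L_{B'}\subset\mathbb P_B$. **Moves.** Put $v_A=L_A\cap Ax_A$, $v=L\cap Ax_A$, $v_B=L_B\cap Ax_B$. For $d_A\ge 0$ and $\tau_A\in(-\pi,\pi]$ the $(d_A,\tau_A)$ moves produce from $L_A$ the line $L_{A'}=T_{X,d_A}(Y)$, where $V$ is the normal to $\mathbb P_A$ at $v_A$, $M=R_{V,\pi/2}(L_A)$, $X=R_{V,\tau_A}(M)$ and $Y=R_{V,\tau_A}(L_A)$. Likewise the $(d,\tau)$ moves produce $L'$ from $L$ in $\mathbb P$ at $v$, and the $(d_B,\tau_B)$ moves produce $L_{B'}$ from $L_B$ in $\mathbb P_B$ at $v_B$. The group obtained by the moves is $\langle A',B'\rangle$ with $A'=\varepsilon_A H_{L_{A'}}H_{L'}$, $B'=\varepsilon_B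 H_{L_{B'}}H_{L'}$ in $SL(2,\mathbb C)$, where the signs are those in $A=\varepsilon_A H_{L_A}H_L$, $B=\varepsilon_B H_{L_B}H_L$. **Theorem.** There are three finite expressions $e_1,e_2,e_3$, built from rational constants, $i$ and the input variables by addition, negation, multiplication, inversion, complex conjugation, principal square roots and the exponential function, which are the same for all groups, planes and parameters and have the following property. For every $A,B$ with chosen ortho-end as above there are three signs (recording the orientations of $L_A,L,L_B$ and depending on nothing else but $A$, $B$ and the ortho-end) such that for every planar triple $(\mathbb P_A,\mathbb P,\mathbb P_B)$ as above: 1. for all parameters $d_A,d,d_B\ge 0$ and $\tau_A,\tau,\tau_B\in(-\pi,\pi]$ there is a group obtained from $G$ by the moves; 2. every group of the planar family is, up to the signs of its two generators, obtained from $G$ by the moves for some such parameters; 3. every group $\langle A',B'\rangle$ obtained from $G$ by the moves with such parameters belongs to the planar family, and $\mathrm{tr}\,A'$, $\mathrm{tr}\,B'$, $\mathrm{tr}\,A'B'^{-1}$ are the values of $e_1,e_2,e_3$ at the entries of $A$ and $B$, the coefficients of the three planes, the three signs and the six parameters; no division by zero occurs in the evaluation. -/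

import Mathlib

open Matrix Complex
open scoped OnePoint MatrixGroups ComplexOrder

namespace PlanarNSDC

noncomputable section

/-! ### Hyperbolic three-space, its lines and planes -/

/-- Homogeneous coordinates of a point of the Riemann sphere. -/
def rep : OnePoint ℂ → Fin 2 → ℂ
  | ∞ => ![1, 0]
  | (z : ℂ) => ![z, 1]

/-- The action of `SL(2, ℂ)` on the Riemann sphere by Möbius transformations. -/
def moeb (g : SL(2, ℂ)) (z : OnePoint ℂ) : OnePoint ℂ := (g : GL (Fin 2) ℂ) • z

/-- Hyperbolic three-space in its Hermitian (hyperboloid) model: positive definite Hermitian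
matrices of determinant one. The point `(z, t)` of the upper half-space corresponds to
`t⁻¹ • !![|z|² + t², z; conj z, 1]`. -/
structure H3 where
  mat : Matrix (Fin 2) (Fin 2) ℂ
  posDef : mat.PosDef
  det_eq : mat.det = 1

/-- An oriented hyperbolic line, given by its ordered pair of distinct ends; it is directed from
`src` to `tgt`. -/
@[ext]
structure Line where
  src : OnePoint ℂ
  tgt : OnePoint ℂ
  ne : src ≠ tgt

/-- The rank one Hermitian (light-like) matrix representing a point at infinity. -/
def ray (z : OnePoint ℂ) : Matrix (Fin 2) (Fin 2) ℂ := vecMulVec (rep z) (star (rep z))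

/-- The point `p` lies on the line `X`: it is a positive combination of the light-like vectors
of the two ends. -/
def Line.Contains (X : Line) (p : H3) : Prop :=
  ∃ s r : ℝ, 0 < s ∧ 0 < r ∧ p.mat = (s : ℂ) • ray X.src + (r : ℂ) • ray X.tgt

/-- The image of an oriented line under a Möbius transformation. -/
def Line.map (g : SL(2, ℂ)) (X : Line) : Line where
  src := moeb g X.src
  tgt := moeb g X.tgt
  ne := fun h => X.ne (MulAction.injective (g : GL (Fin 2) ℂ) h)

/-- The two oriented lines have the same set of ends, that is, they agree up to orientation. -/
def Line.SameUnoriented (X Y : Line) : Prop :=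
  ({X.src, X.tgt} : Set (OnePoint ℂ)) = {Y.src, Y.tgt}

/-- A co-oriented hyperbolic plane. Its horizon is the circle (or straight line with `∞`)
`α |z|² + 2 Re (conj β * z) + γ = 0`; two positively proportional coefficient triples describe
the same co-oriented plane, and a change of all signs changes the co-orientation. -/
structure Plane where
  α : ℝ
  β : ℂ
  γ : ℝ
  nondeg : α * γ < normSq β

/-- The Hermitian matrix of the coefficients of a plane. -/
def Plane.mat (P : Plane) : Matrix (Fin 2) (Fin 2) ℂ :=
  !![(P.α : ℂ), P.β; star P.β, (P.γ : ℂ)]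

/-- The sesquilinear form of the plane on homogeneous coordinates. -/
def Plane.polar (P : Plane) (z w : OnePoint ℂ) : ℂ := star (rep z) ⬝ᵥ (P.mat *ᵥ rep w)

/-- The function whose sign tells on which side of the horizon a point of the sphere lies. For
`z ∈ ℂ` it is `α |z|² + 2 Re (conj β * z) + γ`, and at `∞` it is `α`. -/
def Plane.side (P : Plane) (z : OnePoint ℂ) : ℝ := (P.polar z z).re

/-- The horizon of a plane, a circle on the Riemann sphere. -/
def Plane.horizon (P : Plane) : Set (OnePoint ℂ) := {z | P.side z = 0}

/-- The line `X` lies on the plane `P`. -/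
def Line.LiesOn (X : Line) (P : Plane) : Prop := X.src ∈ P.horizon ∧ X.tgt ∈ P.horizon

/-- `V` is the line through `p` perpendicular to `P` (its ends are inverse to each other in the
horizon of `P`), directed towards the positive side of `P`. -/
def Plane.IsNormalAt (P : Plane) (p : H3) (V : Line) : Prop :=
  V.Contains p ∧ P.polar V.src V.tgt = 0 ∧ 0 < P.side V.tgt

/-! ### Translations, rotations and half-turns -/

/-- The matrix whose columns are homogeneous coordinates of the target and of the source. -/
def Line.frame (X : Line) : Matrix (Fin 2) (Fin 2) ℂ :=
  !![rep X.tgt 0, rep X.src 0; rep X.tgt 1, rep X.src 1]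

lemma Line.frame_det_ne_zero (X : Line) : X.frame.det ≠ 0 := by
  obtain ⟨x, y, h⟩ := X
  induction x using OnePoint.rec <;> induction y using OnePoint.rec <;>
    simp_all [Line.frame, rep, Matrix.det_fin_two, sub_eq_zero]
  · exact h rfl
  · exact fun e => h (congrArg _ e.symm)

/-- The Möbius transformation with axis `X` and complex translation length `δ`, lifted to
`SL(2, ℂ)`: in a coordinate on the sphere with `X.src = 0` and `X.tgt = ∞` it is
`z ↦ exp δ * z`. -/
def Line.lox (X : Line) (δ : ℂ) : SL(2, ℂ) :=
  ⟨X.frame * !![exp (δ / 2), 0; 0, exp (-(δ / 2))] * X.frame⁻¹, by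
    rw [det_mul, det_mul, det_nonsing_inv, mul_right_comm,
      Ring.mul_inverse_cancel _ (isUnit_iff_ne_zero.mpr X.frame_det_ne_zero), one_mul,
      det_fin_two_of, ← exp_add]
    simp⟩

/-- The hyperbolic translation along `X` by the distance `d`. -/
def Line.trans (X : Line) (d : ℝ) : SL(2, ℂ) := X.lox d

/-- The rotation about `X` through the angle `τ`. -/
def Line.rot (X : Line) (τ : ℝ) : SL(2, ℂ) := X.lox (τ * I)

/-- The half-turn about `X`. -/
def Line.halfTurn (X : Line) : SL(2, ℂ) := X.rot Real.pi

/-- The lines `X` and `Y` intersect at right angles: the half-turn about `X` exchanges the ends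
of `Y`. -/
def Line.Perp (X Y : Line) : Prop := moeb X.halfTurn Y.src = Y.tgt

/-- `X` is the (proper) axis of `A`, with one of its two orientations. -/
def IsAxis (A : SL(2, ℂ)) (X : Line) : Prop := {z | moeb A z = z} = {X.src, X.tgt}

/-! ### Ortho-ends, nsdc triples and planar families -/

/-- Labels for the three lines and planes: `a` for `L_A`, `ℙ_A`, `d` for `L`, `ℙ`, and `b` for
`L_B`, `ℙ_B`. -/
inductive Mark where
  | a | d | b

/-- `A` and `A'` are equal to `W` and `W'`, or equal to `-W` and `-W'`. -/
def SameLift (A W A' W' : SL(2, ℂ)) : Prop := (A = W ∧ A' = W') ∨ (A = -W ∧ A' = -W')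

/-- The ends of the lines `L a`, `L d`, `L b` form the ortho-end of the marked group `⟨A, B⟩`:
`L d` is the common perpendicular to the two distinct axes, and in `PSL(2, ℂ)` one has
`A = H_{L a} H_{L d}` and `B = H_{L b} H_{L d}`. -/
def IsOrthoEnd (A B : SL(2, ℂ)) (L : Mark → Line) : Prop :=
  (∃ XA XB : Line, IsAxis A XA ∧ IsAxis B XB ∧ ¬ XA.SameUnoriented XB ∧
    (L .d).Perp XA ∧ (L .d).Perp XB) ∧
  (A = (L .a).halfTurn * (L .d).halfTurn ∨ A = -((L .a).halfTurn * (L .d).halfTurn)) ∧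
  (B = (L .b).halfTurn * (L .d).halfTurn ∨ B = -((L .b).halfTurn * (L .d).halfTurn))

/-- The horizon of `P` separates the horizons of `Q` and `R`. -/
def Plane.Separates (P Q R : Plane) : Prop :=
  ∃ z ∈ Q.horizon, ∃ w ∈ R.horizon, P.side z * P.side w < 0

/-- Non-separating disjoint planar triple: the horizons are pairwise disjoint or tangent, and none
separates the other two. -/
def IsNSDC (P : Mark → Plane) : Prop :=
  (∀ i j, i ≠ j → ((P i).horizon ∩ (P j).horizon).Subsingleton) ∧
  (∀ i j k, i ≠ j → j ≠ k → i ≠ k → ¬ (P i).Separates (P j) (P k))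

/-- The marked groups `⟨A', B'⟩` of the planar family of the triple `P`, given by all lifts to
`SL(2, ℂ)` of their generators: `A' = H_{N a} H_{N d}` and `B' = H_{N b} H_{N d}` in `PSL(2, ℂ)`
for lines `N a`, `N d`, `N b` on the respective planes. -/
def InPlanarFamily (P : Mark → Plane) (A' B' : SL(2, ℂ)) : Prop :=
  ∃ N : Mark → Line, (∀ k, (N k).LiesOn (P k)) ∧
    (A' = (N .a).halfTurn * (N .d).halfTurn ∨ A' = -((N .a).halfTurn * (N .d).halfTurn)) ∧
    (B' = (N .b).halfTurn * (N .d).halfTurn ∨ B' = -((N .b).halfTurn * (N .d).halfTurn))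

/-! ### The moves -/

/-- The parameters `(d_A, τ_A)`, `(d, τ)`, `(d_B, τ_B)`. -/
structure Params where
  dist : Mark → ℝ
  angle : Mark → ℝ

/-- Distances are non-negative and angles lie in `(-π, π]`. -/
def Params.Admissible (p : Params) : Prop :=
  ∀ k, 0 ≤ p.dist k ∧ -Real.pi < p.angle k ∧ p.angle k ≤ Real.pi

/-- `N` arises from the line `L` by the `(d, τ)` moves in the plane `P` with base point `v`. With
`V` the normal of `P` at `v` and `M = R_{V, π/2}(L)` the perpendicular to `L` at `v` in `P`, rotate
`M` and `L` about `V` through `τ` to `X` and `Y`, then translate `Y` along `X` by `d`. -/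
def IsMove (P : Plane) (L : Line) (v : H3) (d τ : ℝ) (N : Line) : Prop :=
  ∃ V : Line, P.IsNormalAt v V ∧
    let M := L.map (V.rot (Real.pi / 2))
    let X := M.map (V.rot τ)
    let Y := L.map (V.rot τ)
    N = Y.map (X.trans d)

/-- The marked group `⟨A', B'⟩` arises from the marked group `⟨A, B⟩` with ortho-end `L` in the
planar family of `P` by the moves with parameters `p`. The base points are
`v_A = L_A ∩ Ax_A`, `v = L ∩ Ax_A` and `v_B = L_B ∩ Ax_B`. The generators are matrices; each new
generator carries the sign that continues that of the old one (when the half-turn matrices are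
moved along with the oriented lines). -/
def ObtainedByMoves (A B : SL(2, ℂ)) (L : Mark → Line) (P : Mark → Plane) (p : Params)
    (A' B' : SL(2, ℂ)) : Prop :=
  ∃ (XA XB : Line) (v : Mark → H3) (N : Mark → Line),
    IsAxis A XA ∧ IsAxis B XB ∧
    (∀ k, (L k).Contains (v k)) ∧
    XA.Contains (v .a) ∧ XA.Contains (v .d) ∧ XB.Contains (v .b) ∧
    (∀ k, IsMove (P k) (L k) (v k) (p.dist k) (p.angle k) (N k)) ∧
    SameLift A ((L .a).halfTurn * (L .d).halfTurn) A' ((N .a).halfTurn * (N .d).halfTurn) ∧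
    SameLift B ((L .b).halfTurn * (L .d).halfTurn) B' ((N .b).halfTurn * (N .d).halfTurn)

/-! ### Explicit elementary expressions -/

/-- Finite expressions in variables from `ι`, built from rational constants and `i` by field
operations, complex conjugation, square roots and exponentials. -/
inductive Expr (ι : Type) where
  | var (i : ι)
  | rat (q : ℚ)
  | imag
  | add (x y : Expr ι)
  | neg (x : Expr ι)
  | mul (x y : Expr ι)
  | inv (x : Expr ι)
  | conj (x : Expr ι)
  | sqrt (x : Expr ι)
  | exp (x : Expr ι)

/-- The value of an expression; square roots are principal. -/
def Expr.eval {ι : Type} (f : ι → ℂ) : Expr ι → ℂ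
  | .var i => f i
  | .rat q => (q : ℂ)
  | .imag => I
  | .add x y => x.eval f + y.eval f
  | .neg x => -x.eval f
  | .mul x y => x.eval f * y.eval f
  | .inv x => (x.eval f)⁻¹
  | .conj x => star (x.eval f)
  | .sqrt x => (x.eval f) ^ (1 / 2 : ℂ)
  | .exp x => Complex.exp (x.eval f)

/-- No division by zero occurs in the evaluation of the expression. -/
def Expr.WellDefined {ι : Type} (f : ι → ℂ) : Expr ι → Prop
  | .var _ => True
  | .rat _ => True
  | .imag => True
  | .add x y => x.WellDefined f ∧ y.WellDefined f
  | .neg x => x.WellDefined f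
  | .mul x y => x.WellDefined f ∧ y.WellDefined f
  | .inv x => x.WellDefined f ∧ x.eval f ≠ 0
  | .conj x => x.WellDefined f
  | .sqrt x => x.WellDefined f
  | .exp x => x.WellDefined f

/-- The expression is well defined at `f` and has the value `z` there. -/
def Expr.Computes {ι : Type} (e : Expr ι) (f : ι → ℂ) (z : ℂ) : Prop :=
  e.WellDefined f ∧ e.eval f = z

/-- The input variables: the entries of the matrices of the base group, the coefficients of the
planes, one sign for each of the three lines, and the six parameters. -/
inductive Input where
  | matA (i j : Fin 2)
  | matB (i j : Fin 2)
  | plane (k : Mark) (i j : Fin 2)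
  | sign (k : Mark)
  | dist (k : Mark)
  | angle (k : Mark)

/-- The values of the input variables. -/
def inputs (A B : SL(2, ℂ)) (P : Mark → Plane) (s : Mark → ℤˣ) (p : Params) : Input → ℂ
  | .matA i j => A i j
  | .matB i j => B i j
  | .plane k i j => (P k).mat i j
  | .sign k => (((s k : ℤˣ) : ℤ) : ℂ)
  | .dist k => (p.dist k : ℂ)
  | .angle k => (p.angle k : ℂ)

end

end PlanarNSDC

namespace PlanarNSDC

/-! ### Homogeneous coordinates -/

/-! An oriented line is encoded by its half-turn matrix h, and every traceless matrix of determinant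
one arises in this way (`exists_halfTurn_eq`). Geometry then becomes matrix algebra. Perpendicular
lines have anticommuting half-turns (`Line.Perp.anticommute`); a point, as a Hermitian matrix p,
lies on the line iff h p hᴴ = p (`Line.contains_iff`); the line lies on a plane with Hermitian
matrix Q iff Q h = hᴴ Q, so that h is self-adjoint for the form Q (`Line.liesOn_iff`).

Let h belong to a line of the plane and let u be the half-turn about the normal at a point of that
line. Then h and u anticommute, h, uh, u form an orthonormal frame of the traceless matrices, and h,
uh, iu are self-adjoint for Q. The lines of the plane are therefore x h + y uh + i z u with real x,
y, z on the hyperboloid x² + y² − z² = 1 (`Plane.exists_coordinates`). The moves produce exactly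
(cosh d cos τ, cosh d sin τ, sinh d) (`halfTurn_move`), polar coordinates on the half z ≥ 0.
Reversing a line negates all three coordinates, so every line is reached up to orientation, and
every group of the family up to the signs of its generators.

For the traces, each matrix must be an explicit function of the inputs. The half-turn about L is a
normalised commutator AB − BA (`exists_commutator_eq`), and those about L_A and L_B follow by
solving the factorisations of A and B. The half-turn about an axis is a normalised traceless part. A
base point is a normalised sum of g gᴴ over the quaternion group generated by two anticommuting
half-turns (`mat_eq_of_contains`), and the normal is a product of adjugates
(`Plane.halfTurn_eq_of_isNormalAt`). The root in the commutator is ambiguous up to one sign; the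
factorisations of A and B contribute the other two. The ambiguous root for the axis disappears
because g gᴴ is insensitive to signs. -/

lemma rep_ne_zero (z : OnePoint ℂ) : rep z ≠ 0 := by
  induction z using OnePoint.rec <;> simp [rep]

lemma exists_eq_smul_rep {w : Fin 2 → ℂ} (hw : w ≠ 0) :
    ∃ (z : OnePoint ℂ) (c : ℂ), c ≠ 0 ∧ w = c • rep z := by
  by_cases h : w 1 = 0
  · refine ⟨∞, w 0, ?_, ?_⟩
    · intro h0
      apply hw
      ext i
      fin_cases i <;> simp [h, h0]
    · ext i
      fin_cases i <;> simp [rep, h]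
  · refine ⟨((w 0 / w 1 : ℂ) : OnePoint ℂ), w 1, h, ?_⟩
    ext i
    fin_cases i <;> simp [rep, h, mul_div_cancel₀]

lemma eq_of_rep_eq_smul {z w : OnePoint ℂ} {c : ℂ} (h : rep z = c • rep w) : z = w := by
  have h0 := congrFun h 0
  have h1 := congrFun h 1
  induction z using OnePoint.rec <;> induction w using OnePoint.rec <;>
    simp only [rep, cons_val_zero, cons_val_one, Pi.smul_apply, smul_eq_mul, mul_one,
      mul_zero] at h0 h1
  · rfl
  · simp [← h1] at h0
  · simp at h1
  · rw [h0, ← h1, one_mul]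

/-- Translates fixed points and images on the sphere into eigenvector equations in ℂ². -/
lemma mulVec_rep (g : SL(2, ℂ)) (z : OnePoint ℂ) :
    ∃ c : ℂ, c ≠ 0 ∧ g.1 *ᵥ rep z = c • rep (moeb g z) := by
  have hdet : g.1 0 0 * g.1 1 1 - g.1 0 1 * g.1 1 0 = 1 := by
    rw [← det_fin_two]; exact g.2
  induction z using OnePoint.rec with
  | infty =>
    by_cases h : g.1 1 0 = 0
    · refine ⟨g.1 0 0, fun h0 => by simp [h, h0] at hdet, ?_⟩
      have : moeb g ∞ = ∞ := by
        simp [moeb, OnePoint.smul_infty_eq_ite, h]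
      rw [this]
      ext i
      fin_cases i <;> simp [rep, h, mulVec, dotProduct]
    · refine ⟨g.1 1 0, h, ?_⟩
      have : moeb g ∞ = ((g.1 0 0 / g.1 1 0 : ℂ) : OnePoint ℂ) := by
        simp [moeb, OnePoint.smul_infty_eq_ite, h]
      rw [this]
      ext i
      fin_cases i <;> simp [rep, h, mulVec, dotProduct, mul_div_cancel₀]
  | coe z =>
    by_cases h : g.1 1 0 * z + g.1 1 1 = 0
    · refine ⟨g.1 0 0 * z + g.1 0 1, fun h0 => ?_, ?_⟩
      · by_cases hc : g.1 1 0 = 0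
        · simp [hc] at h
          simp [hc, h] at hdet
        · apply one_ne_zero (α := ℂ)
          rw [← hdet]
          linear_combination g.1 0 0 * h - g.1 1 0 * h0
      · have : moeb g z = ∞ := by
          simp [moeb, OnePoint.smul_some_eq_ite, h]
        rw [this]
        ext i
        fin_cases i <;> simp [rep, h, mulVec, dotProduct]
    · refine ⟨g.1 1 0 * z + g.1 1 1, h, ?_⟩
      have : moeb g z = (((g.1 0 0 * z + g.1 0 1) / (g.1 1 0 * z + g.1 1 1) : ℂ) : OnePoint ℂ) := by
        simp [moeb, OnePoint.smul_some_eq_ite, h]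
      rw [this]
      ext i
      fin_cases i <;> simp [rep, h, mulVec, dotProduct, mul_div_cancel₀]

lemma moeb_eq_iff (g : SL(2, ℂ)) (z w : OnePoint ℂ) :
    moeb g z = w ↔ ∃ c : ℂ, g.1 *ᵥ rep z = c • rep w := by
  obtain ⟨c, hc, h⟩ := mulVec_rep g z
  constructor
  · rintro rfl
    exact ⟨c, h⟩
  · rintro ⟨k, hk⟩
    apply eq_of_rep_eq_smul (c := c⁻¹ * k)
    rw [mul_smul, ← hk, h, smul_smul, inv_mul_cancel₀ hc, one_smul]

/-! ### Half-turns -/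

/-- The two ends span ℂ². Identities between half-turns are thereby reduced to comparing values on
the ends. -/
lemma eq_of_mulVec_tgt_src (X : Line) {M N : Matrix (Fin 2) (Fin 2) ℂ}
    (ht : M *ᵥ rep X.tgt = N *ᵥ rep X.tgt) (hs : M *ᵥ rep X.src = N *ᵥ rep X.src) : M = N := by
  have hu : IsUnit X.frame := by
    rw [isUnit_iff_isUnit_det]; exact isUnit_iff_ne_zero.mpr X.frame_det_ne_zero
  rw [← hu.mul_left_inj]
  ext i j
  have h1 := congrFun ht i
  have h2 := congrFun hs i
  simp only [mulVec, dotProduct, Fin.sum_univ_two] at h1 h2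
  fin_cases j <;> simp [Line.frame, mul_apply, Fin.sum_univ_two, h1, h2]

lemma Line.frame_isUnit_det (X : Line) : IsUnit X.frame.det :=
  isUnit_iff_ne_zero.mpr X.frame_det_ne_zero

lemma Line.lox_mul_frame (X : Line) (δ : ℂ) :
    (X.lox δ).1 * X.frame = X.frame * !![exp (δ / 2), 0; 0, exp (-(δ / 2))] := by
  simp [Line.lox, mul_assoc, nonsing_inv_mul _ X.frame_isUnit_det]

lemma Line.lox_mulVec_tgt (X : Line) (δ : ℂ) :
    (X.lox δ).1 *ᵥ rep X.tgt = exp (δ / 2) • rep X.tgt := by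
  ext i
  have := congrFun (congrFun (X.lox_mul_frame δ) i) 0
  simp only [mul_apply, Fin.sum_univ_two, Line.frame] at this
  simp only [mulVec, dotProduct, Fin.sum_univ_two]
  fin_cases i <;> simp_all <;> ring

lemma Line.lox_mulVec_src (X : Line) (δ : ℂ) :
    (X.lox δ).1 *ᵥ rep X.src = exp (-(δ / 2)) • rep X.src := by
  ext i
  have := congrFun (congrFun (X.lox_mul_frame δ) i) 1
  simp only [mul_apply, Fin.sum_univ_two, Line.frame] at this
  simp only [mulVec, dotProduct, Fin.sum_univ_two]
  fin_cases i <;> simp_all <;> ring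

lemma exp_pi_mul_I_div_two : exp (Real.pi * I / 2) = I := by
  rw [show (Real.pi * I / 2 : ℂ) = Real.pi / 2 * I by ring, exp_mul_I]
  simp

lemma exp_neg_pi_mul_I_div_two : exp (-(Real.pi * I / 2)) = -I := by
  rw [exp_neg, exp_pi_mul_I_div_two, inv_I]

lemma Line.halfTurn_mulVec_tgt (X : Line) : X.halfTurn.1 *ᵥ rep X.tgt = I • rep X.tgt := by
  rw [Line.halfTurn, Line.rot, Line.lox_mulVec_tgt, exp_pi_mul_I_div_two]

lemma Line.halfTurn_mulVec_src (X : Line) : X.halfTurn.1 *ᵥ rep X.src = (-I) • rep X.src := by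
  rw [Line.halfTurn, Line.rot, Line.lox_mulVec_src, exp_neg_pi_mul_I_div_two]

lemma Line.halfTurn_mul_frame (X : Line) :
    X.halfTurn.1 * X.frame = X.frame * !![I, 0; 0, -I] := by
  rw [Line.halfTurn, Line.rot, Line.lox_mul_frame, exp_pi_mul_I_div_two, exp_neg_pi_mul_I_div_two]

lemma Line.eq_halfTurn (X : Line) {M : Matrix (Fin 2) (Fin 2) ℂ}
    (ht : M *ᵥ rep X.tgt = I • rep X.tgt) (hs : M *ᵥ rep X.src = (-I) • rep X.src) :
    M = X.halfTurn.1 :=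
  eq_of_mulVec_tgt_src X (ht.trans X.halfTurn_mulVec_tgt.symm) (hs.trans X.halfTurn_mulVec_src.symm)

lemma Line.halfTurn_sq (X : Line) : X.halfTurn.1 * X.halfTurn.1 = -1 := by
  apply eq_of_mulVec_tgt_src X
  · simp [← mulVec_mulVec, X.halfTurn_mulVec_tgt, mulVec_smul, smul_smul, neg_mulVec]
  · simp only [← mulVec_mulVec, X.halfTurn_mulVec_src, mulVec_smul, smul_smul, neg_mulVec]
    simp

lemma Line.trace_halfTurn (X : Line) : X.halfTurn.1.trace = 0 := by
  have h : X.halfTurn.1 = X.frame * !![I, 0; 0, -I] * X.frame⁻¹ := by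
    rw [← X.halfTurn_mul_frame, mul_nonsing_inv_cancel_right _ _ X.frame_isUnit_det]
  rw [h, mul_assoc, trace_mul_comm, nonsing_inv_mul_cancel_right _ _ X.frame_isUnit_det]
  simp [trace_fin_two]

/-- The ends are common eigenvectors, and −i times the half-turn has eigenvalue 1 at the target and
−1 at the source; what remains is e^{±δ/2} = cosh(δ/2) ± sinh(δ/2). -/
lemma Line.lox_eq (X : Line) (δ : ℂ) :
    (X.lox δ).1 = cosh (δ / 2) • (1 : Matrix (Fin 2) (Fin 2) ℂ)
      - (I * sinh (δ / 2)) • X.halfTurn.1 := by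
  apply eq_of_mulVec_tgt_src X
  · rw [X.lox_mulVec_tgt, sub_mulVec, smul_mulVec, smul_mulVec, one_mulVec, X.halfTurn_mulVec_tgt,
      smul_smul, ← sub_smul, ← cosh_add_sinh]
    congr 1
    linear_combination sinh (δ / 2) * I_mul_I
  · rw [X.lox_mulVec_src, sub_mulVec, smul_mulVec, smul_mulVec, one_mulVec, X.halfTurn_mulVec_src,
      smul_smul, ← sub_smul, ← cosh_sub_sinh]
    congr 1
    linear_combination -sinh (δ / 2) * I_mul_I

lemma Line.trans_eq (X : Line) (d : ℝ) :
    (X.trans d).1 = cosh (d / 2) • (1 : Matrix (Fin 2) (Fin 2) ℂ)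
      - (I * sinh (d / 2)) • X.halfTurn.1 := X.lox_eq d

lemma Line.rot_eq (X : Line) (τ : ℝ) :
    (X.rot τ).1 = cos (τ / 2) • (1 : Matrix (Fin 2) (Fin 2) ℂ)
      + sin (τ / 2) • X.halfTurn.1 := by
  rw [Line.rot, X.lox_eq, show (τ * I / 2 : ℂ) = τ / 2 * I by ring, cosh_mul_I, sinh_mul_I,
    show I * (sin ((τ : ℂ) / 2) * I) = - sin ((τ : ℂ) / 2) by
      linear_combination sin ((τ : ℂ) / 2) * I_mul_I]
  module

lemma Line.halfTurn_map (g : SL(2, ℂ)) (X : Line) :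
    (X.map g).halfTurn = g * X.halfTurn * g⁻¹ := by
  have key : ∀ (z : OnePoint ℂ) (l : ℂ), X.halfTurn.1 *ᵥ rep z = l • rep z →
      (g * X.halfTurn * g⁻¹).1 *ᵥ rep (moeb g z) = l • rep (moeb g z) := by
    intro z l hz
    obtain ⟨c, hc, h⟩ := mulVec_rep g z
    have h' : rep (moeb g z) = c⁻¹ • (g.1 *ᵥ rep z) := by
      rw [h, smul_smul, inv_mul_cancel₀ hc, one_smul]
    have hg : (g * X.halfTurn * g⁻¹).1 * g.1 = g.1 * X.halfTurn.1 := by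
      have : (g * X.halfTurn * g⁻¹) * g = g * X.halfTurn := by group
      exact congrArg Subtype.val this
    rw [h', mulVec_smul, mulVec_mulVec, hg, ← mulVec_mulVec, hz, mulVec_smul, smul_comm]
  apply Subtype.ext
  exact ((X.map g).eq_halfTurn (key _ _ X.halfTurn_mulVec_tgt) (key _ _ X.halfTurn_mulVec_src)).symm

lemma exists_ker_vec {M : Matrix (Fin 2) (Fin 2) ℂ} (h0 : M.trace = 0) (h1 : M.det = 1) {l : ℂ}
    (hl : l * l = -1) : ∃ z : OnePoint ℂ, M *ᵥ rep z = l • rep z := by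
  have : (M - l • (1 : Matrix (Fin 2) (Fin 2) ℂ)).det = 0 := by
    rw [det_fin_two] at h1 ⊢
    rw [trace_fin_two] at h0
    simp
    linear_combination h1 + hl - l * h0
  obtain ⟨w, hw, h⟩ := exists_mulVec_eq_zero_iff.mpr this
  obtain ⟨z, c, hc, rfl⟩ := exists_eq_smul_rep hw
  refine ⟨z, ?_⟩
  rw [sub_mulVec, smul_mulVec, one_mulVec, mulVec_smul, smul_comm, ← smul_sub] at h
  exact sub_eq_zero.mp ((smul_eq_zero.mp h).resolve_left hc)

/-- The characteristic polynomial is x² + 1. The eigenlines for i and −i are distinct and serve as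
target and source. -/
lemma exists_halfTurn_eq {M : Matrix (Fin 2) (Fin 2) ℂ} (h0 : M.trace = 0) (h1 : M.det = 1) :
    ∃ X : Line, X.halfTurn.1 = M := by
  obtain ⟨t, ht⟩ := exists_ker_vec h0 h1 I_mul_I
  obtain ⟨s, hs⟩ := exists_ker_vec h0 h1 (l := -I) (by simp)
  have hne : s ≠ t := by
    rintro rfl
    rw [ht, neg_smul, eq_neg_iff_add_eq_zero, ← add_smul, smul_eq_zero] at hs
    rcases hs with h | h
    · simp [← two_mul] at h
    · exact rep_ne_zero _ h
  exact ⟨⟨s, t, hne⟩, (Line.eq_halfTurn ⟨s, t, hne⟩ ht hs).symm⟩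

lemma Line.eq_src_or_tgt (X : Line) {z : OnePoint ℂ} {k : ℂ}
    (h : X.halfTurn.1 *ᵥ rep z = k • rep z) : z = X.src ∨ z = X.tgt := by
  set w := X.frame⁻¹ *ᵥ rep z with hw
  have hz : rep z = X.frame *ᵥ w := by
    rw [hw, mulVec_mulVec, mul_nonsing_inv _ X.frame_isUnit_det, one_mulVec]
  have hw2 : !![I, 0; 0, -I] *ᵥ w = k • w := by
    rw [hz, mulVec_mulVec, X.halfTurn_mul_frame, ← mulVec_mulVec, ← mulVec_smul] at h
    exact mulVec_injective_of_isUnit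
      ((isUnit_iff_isUnit_det _).mpr X.frame_isUnit_det) h
  have h0 := congrFun hw2 0
  have h1 := congrFun hw2 1
  simp [mulVec, dotProduct] at h0 h1
  have hz' : rep z = w 0 • rep X.tgt + w 1 • rep X.src := by
    rw [hz]
    ext i
    fin_cases i <;> simp [Line.frame, mulVec, dotProduct, mul_comm]
  by_cases ha : w 0 = 0
  · left
    rw [ha, zero_smul, zero_add] at hz'
    exact eq_of_rep_eq_smul hz'
  · right
    have hk : I = k := by simpa [ha] using h0
    have hb : w 1 = 0 := by
      rw [← hk] at h1
      have : I * w 1 = 0 := by linear_combination -h1 / 2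
      simpa using this
    rw [hb, zero_smul, add_zero] at hz'
    exact eq_of_rep_eq_smul hz'

lemma Line.sameUnoriented_of_halfTurn_eq_smul {X Y : Line} {c : ℂ}
    (h : Y.halfTurn.1 = c • X.halfTurn.1) : X.SameUnoriented Y := by
  have hs := Y.eq_src_or_tgt (z := X.src) (k := c * -I) (by
    rw [h, smul_mulVec, X.halfTurn_mulVec_src, smul_smul])
  have ht := Y.eq_src_or_tgt (z := X.tgt) (k := c * I) (by
    rw [h, smul_mulVec, X.halfTurn_mulVec_tgt, smul_smul])
  have hne := X.ne
  unfold Line.SameUnoriented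
  rcases hs with hs | hs <;> rcases ht with ht | ht
  · exact absurd (hs.trans ht.symm) hne
  · rw [hs, ht]
  · rw [hs, ht, Set.pair_comm]
  · exact absurd (hs.trans ht.symm) hne

/-! ### Traceless matrices -/

section Traceless

variable {M N K : Matrix (Fin 2) (Fin 2) ℂ}

/-- Polarised Cayley–Hamilton identity for traceless matrices. -/
lemma mul_add_mul_eq_trace_smul (hM : M.trace = 0) (hN : N.trace = 0) :
    M * N + N * M = (M * N).trace • 1 := by
  rw [trace_fin_two] at hM hN
  have hM' : M 1 1 = -M 0 0 := by linear_combination hM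
  have hN' : N 1 1 = -N 0 0 := by linear_combination hN
  ext i j
  fin_cases i <;> fin_cases j <;>
    simp [mul_apply, trace_fin_two, hM', hN'] <;> ring

lemma sq_eq_neg_det_smul (hM : M.trace = 0) : M * M = (-M.det) • 1 := by
  rw [trace_fin_two] at hM
  have hM' : M 1 1 = -M 0 0 := by linear_combination hM
  ext i j
  fin_cases i <;> fin_cases j <;>
    simp [mul_apply, det_fin_two, hM'] <;> ring

/-- Commuting turns the scalar anticommutator into a scalar product MN, and M is invertible with
inverse −M. -/
lemma exists_eq_smul_of_commute (hM : M.trace = 0) (hN : N.trace = 0) (hsq : M * M = -1)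
    (h : M * N = N * M) : ∃ c : ℂ, N = c • M := by
  refine ⟨-((M * N).trace / 2), ?_⟩
  have h1 := mul_add_mul_eq_trace_smul hM hN
  rw [← h, ← two_smul ℂ] at h1
  have h2 : M * N = ((M * N).trace / 2) • 1 := by
    rw [div_eq_inv_mul, mul_smul, ← h1, smul_smul]; norm_num
  have h3 : M * (M * N) = -N := by rw [← mul_assoc, hsq, neg_one_mul]
  rw [h2] at h3
  rw [neg_smul, ← neg_eq_iff_eq_neg, ← h3]
  simp

/-- A matrix that commutes with two anticommuting half-turns is a scalar. -/
lemma eq_trace_smul_of_commute_commute (hM : M.trace = 0) (hMs : M * M = -1)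
    (hNs : N * N = -1) (hMN : M * N = -(N * M)) (h1 : M * K = K * M) (h2 : N * K = K * N) :
    K = (K.trace / 2) • 1 := by
  -- The traceless part of K commutes with M, hence equals cM. It also commutes with N, which
  -- anticommutes with M, so c = 0.
  obtain ⟨c, hc⟩ := exists_eq_smul_of_commute (M := M) (N := K - (K.trace / 2) • 1) hM
    (by simp [trace_sub, trace_smul]) hMs (by simp [mul_sub, sub_mul, h1])
  have hN2 : c • (N * M) = c • (M * N) := by
    rw [← mul_smul_comm, ← smul_mul_assoc, ← hc]
    simp [mul_sub, sub_mul, h2]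
  have h3 : (2 * c) • (N * M) = 0 := by
    rw [hMN, smul_neg] at hN2
    rw [two_mul, add_smul]
    nth_rewrite 1 [hN2]
    simp
  have h4 : (2 * c) • (1 : Matrix (Fin 2) (Fin 2) ℂ) = 0 := by
    have : N * (N * M) * M = 1 := by
      rw [← mul_assoc, hNs, neg_one_mul, neg_mul, hMs, neg_neg]
    rw [← this, ← smul_mul_assoc, ← mul_smul_comm, h3]
    simp
  have h5 : c = 0 := by
    have := congrFun (congrFun h4 0) 0
    simpa using this
  rw [h5, zero_smul] at hc
  exact sub_eq_zero.mp hc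

end Traceless

/-! ### Points and planes in terms of half-turns -/

/-- As the half-turn about X squares to −1, it also sends the target of Y back to the source. It
thus swaps the two eigenlines of the other half-turn, whose eigenvalues are opposite. -/
lemma Line.Perp.anticommute {X Y : Line} (h : X.Perp Y) :
    X.halfTurn.1 * Y.halfTurn.1 = -(Y.halfTurn.1 * X.halfTurn.1) := by
  obtain ⟨c, hc⟩ := (moeb_eq_iff _ _ _).mp h
  have h1 : c • (X.halfTurn.1 *ᵥ rep Y.tgt) = -rep Y.src := by
    rw [← mulVec_smul, ← hc, mulVec_mulVec, X.halfTurn_sq, neg_mulVec, one_mulVec]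
  have hc0 : c ≠ 0 := by
    rintro rfl
    rw [zero_smul] at h1
    exact rep_ne_zero _ (neg_eq_zero.mp h1.symm)
  have h2 : X.halfTurn.1 *ᵥ rep Y.tgt = (-c⁻¹) • rep Y.src := by
    rw [neg_smul, ← smul_neg, ← h1, smul_smul, inv_mul_cancel₀ hc0, one_smul]
  apply eq_of_mulVec_tgt_src Y
  · rw [neg_mulVec, ← mulVec_mulVec, ← mulVec_mulVec, Y.halfTurn_mulVec_tgt, mulVec_smul, h2,
      mulVec_smul, Y.halfTurn_mulVec_src]
    module
  · rw [neg_mulVec, ← mulVec_mulVec, ← mulVec_mulVec, Y.halfTurn_mulVec_src, mulVec_smul, hc,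
      mulVec_smul, Y.halfTurn_mulVec_tgt]
    module

lemma det_eq_one_of_traceless {M : Matrix (Fin 2) (Fin 2) ℂ} (h0 : M.trace = 0)
    (h : M * M = -1) : M.det = 1 := by
  rw [sq_eq_neg_det_smul h0] at h
  have := congrFun (congrFun h 0) 0
  simpa using this

/-- A diagonal Hermitian matrix in the frame of a line is a combination of the rays of its ends. -/
lemma Line.frame_mul_diag_mul (X : Line) (a b : ℂ) :
    X.frame * !![a, 0; 0, b] * X.frameᴴ = b • ray X.src + a • ray X.tgt := by
  ext i j
  fin_cases i <;> fin_cases j <;>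
    simp [Line.frame, ray, mul_apply, vecMulVec_apply, Fin.sum_univ_two] <;> ring

lemma Line.exists_frame_coeff (X : Line) (p : Matrix (Fin 2) (Fin 2) ℂ) :
    ∃ m, p = X.frame * m * X.frameᴴ := by
  have hu : IsUnit X.frameᴴ.det := by
    rw [det_conjTranspose]; exact X.frame_isUnit_det.star
  refine ⟨X.frame⁻¹ * p * (X.frameᴴ)⁻¹, ?_⟩
  rw [mul_assoc X.frame⁻¹, mul_nonsing_inv_cancel_left _ _ X.frame_isUnit_det,
    nonsing_inv_mul_cancel_right _ _ hu]

lemma Line.frame_cancel (X : Line) {m n : Matrix (Fin 2) (Fin 2) ℂ}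
    (h : X.frame * m * X.frameᴴ = X.frame * n * X.frameᴴ) : m = n := by
  have hu : IsUnit X.frameᴴ.det := by
    rw [det_conjTranspose]; exact X.frame_isUnit_det.star
  have hu' : IsUnit X.frameᴴ := (isUnit_iff_isUnit_det _).mpr hu
  have hv : IsUnit X.frame := (isUnit_iff_isUnit_det _).mpr X.frame_isUnit_det
  rw [hu'.mul_left_inj, hv.mul_right_inj] at h
  exact h

lemma Line.halfTurn_conj_frame (X : Line) (m : Matrix (Fin 2) (Fin 2) ℂ) :
    X.halfTurn.1 * (X.frame * m * X.frameᴴ) * X.halfTurn.1ᴴ =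
      X.frame * !![m 0 0, -m 0 1; -m 1 0, m 1 1] * X.frameᴴ := by
  have h : X.frameᴴ * X.halfTurn.1ᴴ = !![I, 0; 0, -I]ᴴ * X.frameᴴ := by
    rw [← conjTranspose_mul, X.halfTurn_mul_frame, conjTranspose_mul]
  have hD : !![I, 0; 0, -I] * m * !![I, 0; 0, -I]ᴴ = !![m 0 0, -m 0 1; -m 1 0, m 1 1] := by
    ext i j
    fin_cases i <;> fin_cases j <;>
      simp [mul_apply, vecMul, dotProduct, Fin.sum_univ_two, mul_right_comm I _ I]
  calc _ = (X.halfTurn.1 * X.frame) * m * (X.frameᴴ * X.halfTurn.1ᴴ) := by simp only [mul_assoc]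
    _ = X.frame * (!![I, 0; 0, -I] * m * !![I, 0; 0, -I]ᴴ) * X.frameᴴ := by
      rw [h, X.halfTurn_mul_frame]; simp only [mul_assoc]
    _ = _ := by rw [hD]

/-- In the frame of the line the conjugation flips the off-diagonal entries, so invariance means
being diagonal; positive definiteness makes both diagonal coefficients positive. -/
lemma Line.contains_iff {X : Line} {p : H3} :
    X.Contains p ↔ X.halfTurn.1 * p.mat * X.halfTurn.1ᴴ = p.mat := by
  constructor
  · rintro ⟨s, r, -, -, h⟩
    rw [h, ← X.frame_mul_diag_mul, X.halfTurn_conj_frame]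
    simp
  · intro h
    obtain ⟨m, hm⟩ := X.exists_frame_coeff p.mat
    rw [hm, X.halfTurn_conj_frame] at h
    have h' := X.frame_cancel h
    have h01 : m 0 1 = 0 := by
      have := congrFun (congrFun h' 0) 1
      simp at this
      linear_combination -this / 2
    have h10 : m 1 0 = 0 := by
      have := congrFun (congrFun h' 1) 0
      simp at this
      linear_combination -this / 2
    have hmp : m.PosDef := by
      have := p.posDef
      rw [hm] at this
      exact (Matrix.IsUnit.posDef_star_right_conjugate_iff
        ((isUnit_iff_isUnit_det _).mpr X.frame_isUnit_det)).mp this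
    have h0 := hmp.diag_pos (i := 0)
    have h1 := hmp.diag_pos (i := 1)
    rw [pos_iff] at h0 h1
    refine ⟨(m 1 1).re, (m 0 0).re, h1.1, h0.1, ?_⟩
    have e0 : ((m 0 0).re : ℂ) = m 0 0 := by apply Complex.ext <;> simp [h0.2]
    have e1 : ((m 1 1).re : ℂ) = m 1 1 := by apply Complex.ext <;> simp [h1.2]
    rw [e0, e1, ← X.frame_mul_diag_mul, hm]
    congr 2
    ext i j
    fin_cases i <;> fin_cases j <;> simp [h01, h10]

/-! ### Planes as Hermitian forms, and their normals. -/

lemma Plane.mat_isHermitian (P : Plane) : P.mat.IsHermitian := by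
  ext i j
  fin_cases i <;> fin_cases j <;> simp [Plane.mat]

lemma Plane.det_mat (P : Plane) : P.mat.det = ((P.α * P.γ - normSq P.β : ℝ) : ℂ) := by
  simp [Plane.mat, det_fin_two, mul_conj]

lemma Plane.conj_polar (P : Plane) (z w : OnePoint ℂ) : star (P.polar z w) = P.polar w z := by
  simp [Plane.polar, Plane.mat, mulVec, dotProduct]
  ring

lemma Plane.polar_self (P : Plane) (z : OnePoint ℂ) : P.polar z z = (P.side z : ℂ) := by
  have h := P.conj_polar z z
  exact (conj_eq_iff_re.mp h).symm

/-- The Gram matrix of the form of a plane in the frame of a line. -/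
lemma Plane.frame_gram (P : Plane) (X : Line) :
    X.frameᴴ * P.mat * X.frame =
      !![(P.side X.tgt : ℂ), P.polar X.tgt X.src; P.polar X.src X.tgt, (P.side X.src : ℂ)] := by
  rw [← P.polar_self, ← P.polar_self]
  ext i j
  fin_cases i <;> fin_cases j <;>
    simp [Line.frame, Plane.polar, mul_apply, mulVec, dotProduct, Fin.sum_univ_two] <;> ring

lemma Line.frame_gram_cancel (X : Line) {M N : Matrix (Fin 2) (Fin 2) ℂ} :
    X.frameᴴ * M * X.frame = X.frameᴴ * N * X.frame ↔ M = N := by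
  have hu : IsUnit X.frameᴴ.det := by
    rw [det_conjTranspose]; exact X.frame_isUnit_det.star
  have hu' : IsUnit X.frameᴴ := (isUnit_iff_isUnit_det _).mpr hu
  have hv : IsUnit X.frame := (isUnit_iff_isUnit_det _).mpr X.frame_isUnit_det
  rw [hv.mul_left_inj, hu'.mul_right_inj]

lemma Line.frame_conjTranspose_mul_halfTurn (X : Line) :
    X.frameᴴ * X.halfTurn.1ᴴ = !![-I, 0; 0, I] * X.frameᴴ := by
  rw [← conjTranspose_mul, X.halfTurn_mul_frame, conjTranspose_mul]
  congr 1
  ext i j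
  fin_cases i <;> fin_cases j <;> simp

/-- In the frame of the line, self-adjointness of diag(i, −i) says that the Gram matrix has zero
diagonal, and its diagonal entries are the side values at the ends. -/
lemma Line.liesOn_iff {X : Line} {P : Plane} :
    X.LiesOn P ↔ P.mat * X.halfTurn.1 = X.halfTurn.1ᴴ * P.mat := by
  rw [← X.frame_gram_cancel]
  have h1 : X.frameᴴ * (P.mat * X.halfTurn.1) * X.frame =
      X.frameᴴ * P.mat * X.frame * !![I, 0; 0, -I] := by
    rw [mul_assoc, mul_assoc P.mat, X.halfTurn_mul_frame]; simp only [mul_assoc]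
  have h2 : X.frameᴴ * (X.halfTurn.1ᴴ * P.mat) * X.frame =
      !![-I, 0; 0, I] * (X.frameᴴ * P.mat * X.frame) := by
    rw [← mul_assoc X.frameᴴ, X.frame_conjTranspose_mul_halfTurn]; simp only [mul_assoc]
  rw [h1, h2, P.frame_gram]
  simp only [Line.LiesOn, Plane.horizon, Set.mem_ofPred_eq]
  constructor
  · rintro ⟨hs, ht⟩
    ext i j
    fin_cases i <;> fin_cases j <;> simp [hs, ht, mul_comm]
  · intro h
    have h00 := congrFun (congrFun h 0) 0
    have h11 := congrFun (congrFun h 1) 1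
    simp at h00 h11
    constructor
    · have : (P.side X.src : ℂ) * I = 0 := by linear_combination -h11 / 2
      simpa using this
    · have : (P.side X.tgt : ℂ) * I = 0 := by linear_combination h00 / 2
      simpa using this

lemma trace_mul_ray (M : Matrix (Fin 2) (Fin 2) ℂ) (z : OnePoint ℂ) :
    (M * ray z).trace = star (rep z) ⬝ᵥ (M *ᵥ rep z) := by
  simp [ray, trace_fin_two, mul_apply, vecMulVec_apply, mulVec, dotProduct]
  ring

/-- The point `p` lies on the plane `P` if it lies on a line of `P`. -/
lemma Line.LiesOn.trace_eq_zero {X : Line} {P : Plane} {p : H3} (h : X.LiesOn P)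
    (hp : X.Contains p) : (P.mat * p.mat).trace = 0 := by
  obtain ⟨s, r, -, -, e⟩ := hp
  rw [e, mul_add, mul_smul_comm, mul_smul_comm, trace_add, trace_smul, trace_smul,
    trace_mul_ray, trace_mul_ray]
  change _ • P.polar _ _ + _ • P.polar _ _ = 0
  have h1 : P.side X.src = 0 := h.1
  have h2 : P.side X.tgt = 0 := h.2
  rw [P.polar_self, P.polar_self, h1, h2]
  simp

/-- The square root of minus the determinant of a plane. -/
noncomputable def Plane.scale (P : Plane) : ℝ := Real.sqrt (normSq P.β - P.α * P.γ)

lemma Plane.scale_pos (P : Plane) : 0 < P.scale := Real.sqrt_pos.mpr (sub_pos.mpr P.nondeg)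

lemma Plane.det_eq_neg_scale_sq (P : Plane) : P.mat.det = -((P.scale : ℂ) ^ 2) := by
  rw [P.det_mat, ← ofReal_pow, Plane.scale, Real.sq_sqrt (sub_pos.mpr P.nondeg).le]
  push_cast; ring

lemma Plane.mul_halfTurn_mul_eq_iff {P : Plane} {V : Line} {p : Matrix (Fin 2) (Fin 2) ℂ}
    {s r c : ℂ} (hp : p = s • ray V.src + r • ray V.tgt) :
    P.mat * V.halfTurn.1 * p = (I * c) • 1 ↔
      P.side V.tgt * r = c ∧ P.polar V.tgt V.src * s = 0 ∧ P.polar V.src V.tgt * r = 0 ∧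
        -P.side V.src * s = c := by
  have hu : IsUnit V.frameᴴ := by
    rw [isUnit_iff_isUnit_det, det_conjTranspose]; exact V.frame_isUnit_det.star
  have key : V.frameᴴ * (P.mat * V.halfTurn.1 * p) =
      !![I * (P.side V.tgt * r), -I * (P.polar V.tgt V.src * s);
        I * (P.polar V.src V.tgt * r), I * (-P.side V.src * s)] * V.frameᴴ := by
    rw [hp, ← V.frame_mul_diag_mul]
    calc _ = V.frameᴴ * P.mat * (V.halfTurn.1 * V.frame) * !![r, 0; 0, s] * V.frameᴴ := by
          simp only [mul_assoc]
      _ = (V.frameᴴ * P.mat * V.frame) * (!![I, 0; 0, -I] * !![r, 0; 0, s]) * V.frameᴴ := by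
          rw [V.halfTurn_mul_frame]; simp only [mul_assoc]
      _ = _ := by
          rw [P.frame_gram]
          congr 1
          ext i j
          fin_cases i <;> fin_cases j <;> simp <;> ring
  have hone : V.frameᴴ * ((I * c) • (1 : Matrix (Fin 2) (Fin 2) ℂ)) =
      !![I * c, 0; 0, I * c] * V.frameᴴ := by
    ext i j
    fin_cases i <;> fin_cases j <;> simp [mul_apply, Fin.sum_univ_two, mul_comm]
  rw [← hu.mul_right_inj, key, hone, hu.mul_left_inj]
  simp only [EmbeddingLike.apply_eq_iff_eq, vecCons_inj, and_true, mul_eq_mul_left_iff, I_ne_zero,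
    or_false, and_assoc, neg_mul, neg_eq_zero, mul_eq_zero, false_or]

/-- The frame of a normal diagonalises both the plane and the point, and the trace condition makes
the diagonal entries of their product opposite; inserting diag(i, −i) gives a scalar. Determinants
fix that scalar up to sign, and the co-orientation fixes the sign. -/
lemma Plane.isNormalAt_iff {P : Plane} {p : H3} {V : Line} (h0 : (P.mat * p.mat).trace = 0) :
    P.IsNormalAt p V ↔ P.mat * V.halfTurn.1 * p.mat = (I * P.scale) • 1 := by
  have hc := P.scale_pos
  constructor
  · rintro ⟨⟨s, r, hs, hr, hp⟩, hpol, hside⟩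
    have h1 : P.side V.src * s + P.side V.tgt * r = 0 := by
      rw [hp, mul_add, mul_smul_comm, mul_smul_comm, trace_add, trace_smul, trace_smul,
        trace_mul_ray, trace_mul_ray] at h0
      change _ • P.polar _ _ + _ • P.polar _ _ = 0 at h0
      rw [P.polar_self, P.polar_self, smul_eq_mul, smul_eq_mul] at h0
      norm_cast at h0
      linear_combination h0
    have h2 : P.polar V.tgt V.src = 0 := by rw [← P.conj_polar, hpol, star_zero]
    have key := (mul_halfTurn_mul_eq_iff (P := P) (c := ((P.side V.tgt * r : ℝ) : ℂ)) hp).mpr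
      ⟨by push_cast; ring, by simp [h2], by simp [hpol], by
        rw [← ofReal_neg, ← ofReal_mul]; congr 1; linear_combination -h1⟩
    have hdet := congrArg det key
    rw [det_mul, det_mul, p.det_eq, V.halfTurn.2, P.det_eq_neg_scale_sq, det_smul] at hdet
    simp only [mul_one, Fintype.card_fin, det_one, mul_pow, I_sq, neg_one_mul, neg_inj] at hdet
    norm_cast at hdet
    rw [key, (pow_left_inj₀ hc.le (mul_pos hside hr).le two_ne_zero).mp hdet]
  · intro h
    have hQ : IsUnit P.mat := by
      rw [isUnit_iff_isUnit_det, P.det_eq_neg_scale_sq, isUnit_iff_ne_zero]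
      simp [hc.ne']
    have hG : P.mat * (V.halfTurn.1 * p.mat) = (I * P.scale) • 1 := by rw [← mul_assoc, h]
    -- Conjugate transposition gives the same relation with factors in the opposite order; inverses
    -- commute, so the order can be restored. Cancelling the plane matrix then puts p on V.
    have hG2 : P.mat * (p.mat * V.halfTurn.1ᴴ) = -((I * P.scale) • 1) := by
      have h1 := congrArg conjTranspose hG
      rw [conjTranspose_mul, conjTranspose_mul, P.mat_isHermitian.eq, p.posDef.1.eq] at h1
      have h2 : (p.mat * V.halfTurn.1ᴴ) * P.mat = (-(I * P.scale)) • 1 := by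
        rw [h1]; simp
      have hne : -(I * (P.scale : ℂ)) ≠ 0 := by simp [hc.ne']
      have h3 : ((-(I * (P.scale : ℂ)))⁻¹ • (p.mat * V.halfTurn.1ᴴ)) * P.mat = 1 := by
        rw [smul_mul_assoc, h2, smul_smul, inv_mul_cancel₀ hne, one_smul]
      have h4 := mul_eq_one_comm.mp h3
      rw [mul_smul_comm, inv_smul_eq_iff₀ hne] at h4
      rw [h4, neg_smul]
    have hcon : V.Contains p := by
      rw [Line.contains_iff]
      have : p.mat * V.halfTurn.1ᴴ = -(V.halfTurn.1 * p.mat) := by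
        rw [← hQ.mul_right_inj, hG2, mul_neg, hG]
      rw [mul_assoc, this, mul_neg, ← mul_assoc, V.halfTurn_sq, neg_one_mul, neg_neg]
    obtain ⟨s, r, hs, hr, hp⟩ := hcon
    obtain ⟨h1, -, h3, -⟩ := (mul_halfTurn_mul_eq_iff hp).mp h
    refine ⟨⟨s, r, hs, hr, hp⟩, ?_, ?_⟩
    · exact (mul_eq_zero.mp h3).resolve_right (by exact_mod_cast hr.ne')
    · have h1' : P.side V.tgt * r = P.scale := by exact_mod_cast h1
      by_contra hn
      nlinarith

/-- Solves the scalar equation for the half-turn by adjugates. This determines the normal uniquely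
and makes it explicit in the plane and the point. -/
lemma Plane.halfTurn_eq_of_isNormalAt {P : Plane} {p : H3} {V : Line}
    (h0 : (P.mat * p.mat).trace = 0) (h : P.IsNormalAt p V) :
    V.halfTurn.1 = (-I * (P.scale : ℂ)⁻¹) • (P.mat.adjugate * p.mat.adjugate) := by
  rw [isNormalAt_iff h0] at h
  have hc : (P.scale : ℂ) ≠ 0 := by exact_mod_cast P.scale_pos.ne'
  have h1 : P.mat.adjugate * (P.mat * V.halfTurn.1 * p.mat) * p.mat.adjugate =
      -((P.scale : ℂ) ^ 2) • V.halfTurn.1 := by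
    calc _ = (P.mat.adjugate * P.mat) * V.halfTurn.1 * (p.mat * p.mat.adjugate) := by
          simp only [mul_assoc]
      _ = _ := by
          rw [adjugate_mul, mul_adjugate, p.det_eq, P.det_eq_neg_scale_sq]
          simp
  rw [h] at h1
  rw [mul_smul_comm, mul_one, smul_mul_assoc] at h1
  have h2 : V.halfTurn.1 = (-((P.scale : ℂ) ^ 2))⁻¹ • -((P.scale : ℂ) ^ 2) • V.halfTurn.1 := by
    rw [smul_smul, inv_mul_cancel₀ (by simp [hc]), one_smul]
  rw [h2, ← h1, smul_smul]
  congr 1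
  field_simp

/-- The explicit formula defines a line: incidence of the point with the plane is exactly
tracelessness, and the scale normalises the determinant. -/
lemma Plane.exists_isNormalAt {P : Plane} {p : H3} (h0 : (P.mat * p.mat).trace = 0) :
    ∃ V, P.IsNormalAt p V := by
  have hc : (P.scale : ℂ) ≠ 0 := by exact_mod_cast P.scale_pos.ne'
  obtain ⟨V, hV⟩ := exists_halfTurn_eq
    (M := (-I * (P.scale : ℂ)⁻¹) • (P.mat.adjugate * p.mat.adjugate))
    (by
      have : (P.mat.adjugate * p.mat.adjugate).trace = (P.mat * p.mat).trace := by
        simp [trace_fin_two, adjugate_fin_two, mul_apply, Fin.sum_univ_two]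
        ring
      rw [trace_smul, this, h0, smul_zero])
    (by
      rw [det_smul, det_mul, det_adjugate, det_adjugate, p.det_eq, P.det_eq_neg_scale_sq]
      simp only [Fintype.card_fin, mul_pow, neg_sq, I_sq]
      field_simp
      simp)
  refine ⟨V, (isNormalAt_iff h0).mpr ?_⟩
  rw [hV, mul_smul_comm, smul_mul_assoc, ← mul_assoc, mul_adjugate, mul_assoc, adjugate_mul,
    p.det_eq, P.det_eq_neg_scale_sq]
  rw [one_smul, mul_one, smul_smul]
  congr 1
  field_simp

/-! ### Anticommuting half-turns and the moves -/

section Quaternion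

variable {h u n K : Matrix (Fin 2) (Fin 2) ℂ}

lemma trace_mul_eq_zero_of_anticommute (ha : h * u = -(u * h)) : (h * u).trace = 0 := by
  have := congrArg trace ha
  rw [trace_neg, trace_mul_comm u h] at this
  linear_combination this / 2

/-- Averaging over the quaternion group generated by two anticommuting half-turns. -/
lemma quaternion_average (hh : h.trace = 0) (h2 : h * h = -1) (u2 : u * u = -1)
    (ha : h * u = -(u * h)) :
    K - h * K * h - u * K * u - h * u * K * (h * u) = (2 * K.trace) • 1 := by
  have hu : u * h = -(h * u) := by rw [ha, neg_neg]
  have c1 : h * (h * u) = -u := by rw [← mul_assoc, h2, neg_one_mul]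
  have c2 : h * u * h = u := by rw [mul_assoc, hu, mul_neg, c1, neg_neg]
  have c3 : u * (h * u) = h := by rw [← mul_assoc, hu, neg_mul, mul_assoc, u2, mul_neg_one, neg_neg]
  have c4 : h * u * u = -h := by rw [mul_assoc, u2, mul_neg_one]
  -- The average commutes with both generators, hence is a scalar, which its trace then determines.
  have hc1 : h * (K - h * K * h - u * K * u - h * u * K * (h * u)) =
      (K - h * K * h - u * K * u - h * u * K * (h * u)) * h := by
    have e1 : h * (h * K * h) = -(K * h) := by simp only [← mul_assoc, h2]; simp
    have e2 : h * (u * K * u) = h * u * K * u := by simp only [← mul_assoc]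
    have e3 : h * (h * u * K * (h * u)) = -(u * K * (h * u)) := by
      rw [← mul_assoc h (h * u * K), ← mul_assoc h (h * u) K, c1]; simp only [neg_mul]
    have e4 : h * K * h * h = -(h * K) := by rw [mul_assoc, h2, mul_neg_one]
    have e5 : u * K * u * h = -(u * K * (h * u)) := by rw [mul_assoc, hu, mul_neg]
    have e6 : h * u * K * (h * u) * h = h * u * K * u := by rw [mul_assoc _ (h * u), c2]
    simp only [mul_sub, sub_mul, e1, e2, e3, e4, e5, e6]
    abel
  have hc2 : u * (K - h * K * h - u * K * u - h * u * K * (h * u)) =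
      (K - h * K * h - u * K * u - h * u * K * (h * u)) * u := by
    have e1 : u * (h * K * h) = -(h * u * K * h) := by
      rw [← mul_assoc, ← mul_assoc, hu]; simp only [neg_mul]
    have e2 : u * (u * K * u) = -(K * u) := by simp only [← mul_assoc, u2]; simp
    have e3 : u * (h * u * K * (h * u)) = h * K * (h * u) := by
      rw [← mul_assoc u (h * u * K), ← mul_assoc u (h * u) K, c3]
    have e4 : h * K * h * u = h * K * (h * u) := by rw [mul_assoc]
    have e5 : u * K * u * u = -(u * K) := by rw [mul_assoc, u2, mul_neg_one]
    have e6 : h * u * K * (h * u) * u = -(h * u * K * h) := by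
      rw [mul_assoc _ (h * u), c4, mul_neg]
    simp only [mul_sub, sub_mul, e1, e2, e3, e4, e5, e6]
    abel
  rw [eq_trace_smul_of_commute_commute hh h2 u2 ha hc1 hc2]
  congr 1
  have t1 : (h * K * h).trace = -K.trace := by
    rw [trace_mul_comm, ← mul_assoc, h2, neg_one_mul, trace_neg]
  have t2 : (u * K * u).trace = -K.trace := by
    rw [trace_mul_comm, ← mul_assoc, u2, neg_one_mul, trace_neg]
  have t3 : (h * u * K * (h * u)).trace = -K.trace := by
    rw [trace_mul_comm, ← mul_assoc, ← mul_assoc, c2, u2, neg_one_mul, trace_neg]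
  rw [trace_sub, trace_sub, trace_sub, t1, t2, t3]
  ring

/-- Coordinates of a traceless matrix with respect to an orthonormal triple of half-turns. -/
lemma traceless_expansion (hh : h.trace = 0) (hu : u.trace = 0) (h2 : h * h = -1)
    (u2 : u * u = -1) (ha : h * u = -(u * h)) (hn : n.trace = 0) :
    n = (-(h * n).trace / 2) • h + (-((u * h) * n).trace / 2) • (u * h) +
      (-(u * n).trace / 2) • u := by
  have key : ∀ {m : Matrix (Fin 2) (Fin 2) ℂ}, m.trace = 0 → m * m = -1 →
      m * n * m = (m * n).trace • m + n := by
    intro m hm m2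
    have h1 := congrArg (· * m) (mul_add_mul_eq_trace_smul hm hn)
    simp only [add_mul, smul_mul_assoc, one_mul] at h1
    rw [mul_assoc n, m2, mul_neg_one] at h1
    rw [← h1]
    abel
  have ht : (u * h).trace = 0 := by
    rw [trace_mul_comm]; exact trace_mul_eq_zero_of_anticommute ha
  have hsq : u * h * (u * h) = -1 := by
    rw [mul_assoc, ← mul_assoc h, ha, neg_mul, mul_assoc u h h, h2, mul_neg, mul_neg_one, mul_neg,
      neg_neg, u2]
  -- Since n is traceless its average vanishes; rewriting each conjugate by `key` solves this
  -- relation for n.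
  have h0 := quaternion_average (K := n) hh h2 u2 ha
  have h3 : h * u * n * (h * u) = u * h * n * (u * h) := by
    rw [ha]; simp only [neg_mul, mul_neg, neg_neg]
  rw [h3, key hh h2, key hu u2, key ht hsq, hn, mul_zero, zero_smul] at h0
  have h4 : (2 : ℂ) • n = (-(h * n).trace) • h + (-((u * h) * n).trace) • (u * h) +
      (-(u * n).trace) • u := by
    rw [← sub_eq_zero, ← neg_eq_zero, ← h0]
    module
  calc n = (1 / 2 : ℂ) • (2 : ℂ) • n := by rw [smul_smul]; norm_num
    _ = _ := by rw [h4]; module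

lemma sq_coordinates {x y w : ℂ} (h2 : h * h = -1) (u2 : u * u = -1) (ha : h * u = -(u * h))
    (hn : n = x • h + y • (u * h) + w • u) (n2 : n * n = -1) : x ^ 2 + y ^ 2 + w ^ 2 = 1 := by
  have c1 : h * (u * h) = u := by rw [← mul_assoc, ha, neg_mul, mul_assoc, h2, mul_neg_one, neg_neg]
  have c2 : u * h * h = -u := by rw [mul_assoc, h2, mul_neg_one]
  have c3 : u * (u * h) = -h := by rw [← mul_assoc, u2, neg_one_mul]
  have c4 : u * h * u = h := by rw [mul_assoc, ha, mul_neg, c3, neg_neg]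
  have c5 : u * h * (u * h) = -1 := by rw [← mul_assoc, c4, h2]
  have key : n * n = (-(x ^ 2 + y ^ 2 + w ^ 2)) • 1 := by
    rw [hn]
    simp only [mul_add, add_mul, smul_mul_assoc, mul_smul_comm, c1, c2, c3, c4, c5, h2, u2, ha]
    module
  rw [n2] at key
  have := congrFun (congrFun key 0) 0
  simp only [Matrix.neg_apply, one_apply_eq, Matrix.smul_apply, smul_eq_mul, mul_one,
    neg_inj] at this
  exact this.symm

/-- Here g⁻¹ = a − bu, and moving h across it gives (a + bu)h, so the conjugate is g²h. This
squaring turns half-angles into full angles. -/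
lemma mul_mul_inv_eq {g : SL(2, ℂ)} {a b : ℂ} (hg : g.1 = a • 1 + b • u) (hu : u.trace = 0)
    (u2 : u * u = -1) (ha : h * u = -(u * h)) :
    g.1 * h * (g⁻¹).1 = ((a ^ 2 - b ^ 2) • 1 + (2 * a * b) • u) * h := by
  have hab : a ^ 2 + b ^ 2 = 1 := by
    have h1 := g.2
    have h2 : u.det = 1 := det_eq_one_of_traceless hu u2
    rw [hg, det_fin_two] at h1
    rw [trace_fin_two] at hu
    rw [det_fin_two] at h2
    simp at h1
    linear_combination h1 - b ^ 2 * h2 - a * b * hu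
  have hinv : (g⁻¹).1 = a • 1 - b • u := by
    have h1 : g.1 * (a • 1 - b • u) = 1 := by
      rw [hg]
      simp only [mul_sub, add_mul, smul_mul_assoc, mul_smul_comm, u2, one_mul, mul_one]
      trans (a ^ 2 + b ^ 2) • (1 : Matrix (Fin 2) (Fin 2) ℂ)
      · module
      · rw [hab, one_smul]
    have h2 : (g⁻¹).1 * g.1 = 1 := congrArg Subtype.val (inv_mul_cancel g)
    calc (g⁻¹).1 = (g⁻¹).1 * (g.1 * (a • 1 - b • u)) := by rw [h1, mul_one]
      _ = _ := by rw [← mul_assoc, h2, one_mul]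
  rw [hinv, hg]
  simp only [mul_sub, add_mul, smul_mul_assoc, mul_smul_comm, one_mul, mul_one, ha, mul_assoc]
  have : u * (u * h) = -h := by rw [← mul_assoc, u2, neg_one_mul]
  rw [mul_neg, this]
  module

end Quaternion

/-! ### The moves in terms of half-turns. -/

lemma halfTurn_map_val (g : SL(2, ℂ)) (X : Line) :
    (X.map g).halfTurn.1 = g.1 * X.halfTurn.1 * (g⁻¹).1 :=
  congrArg Subtype.val (X.halfTurn_map g)

lemma halfTurn_map_rot {V L : Line}
    (ha : L.halfTurn.1 * V.halfTurn.1 = -(V.halfTurn.1 * L.halfTurn.1)) (τ : ℝ) :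
    (L.map (V.rot τ)).halfTurn.1 =
      cos τ • L.halfTurn.1 + sin τ • (V.halfTurn.1 * L.halfTurn.1) := by
  rw [halfTurn_map_val, mul_mul_inv_eq (V.rot_eq τ) V.trace_halfTurn V.halfTurn_sq ha]
  have h1 : cos (τ / 2) ^ 2 - sin (τ / 2) ^ 2 = cos τ := by
    rw [← cos_two_mul', mul_div_cancel₀ _ two_ne_zero]
  have h2 : 2 * cos (τ / 2) * sin (τ / 2) = sin τ := by
    rw [mul_right_comm, ← sin_two_mul, mul_div_cancel₀ _ two_ne_zero]
  rw [h1, h2, add_mul, smul_mul_assoc, smul_mul_assoc, one_mul]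

/-- The half-turn about M is uh. The rotation acts in the span of h and uh; afterwards the product
of the half-turns about X and Y is −u, so the translation mixes Y with the normal only. -/
lemma halfTurn_move {V L : Line}
    (ha : L.halfTurn.1 * V.halfTurn.1 = -(V.halfTurn.1 * L.halfTurn.1)) (d τ : ℝ) :
    ((L.map (V.rot τ)).map
      (((L.map (V.rot (Real.pi / 2))).map (V.rot τ)).trans d)).halfTurn.1 =
      (cosh d * cos τ) • L.halfTurn.1 + (cosh d * sin τ) • (V.halfTurn.1 * L.halfTurn.1) +
        (I * sinh d) • V.halfTurn.1 := by
  set h := L.halfTurn.1 with hh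
  set u := V.halfTurn.1 with hu
  have h2 : h * h = -1 := L.halfTurn_sq
  have u2 : u * u = -1 := V.halfTurn_sq
  have hM : (L.map (V.rot (Real.pi / 2))).halfTurn.1 = u * h := by
    rw [halfTurn_map_rot ha]
    simp [hu, hh]
  have c3 : u * (u * h) = -h := by rw [← mul_assoc, u2, neg_one_mul]
  have hMa : (u * h) * u = -(u * (u * h)) := by
    rw [mul_assoc, ha, mul_neg]
  have hX : ((L.map (V.rot (Real.pi / 2))).map (V.rot τ)).halfTurn.1 =
      cos τ • (u * h) - sin τ • h := by
    rw [halfTurn_map_rot (by rw [hM]; exact hMa), hM, ← hu, c3]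
    module
  set X := (L.map (V.rot (Real.pi / 2))).map (V.rot τ)
  have hY := halfTurn_map_rot ha τ
  rw [← hh, ← hu] at hY
  set Y := L.map (V.rot τ)
  have c1 : h * (u * h) = u := by rw [← mul_assoc, ha, neg_mul, mul_assoc, h2, mul_neg_one, neg_neg]
  have c2 : u * h * h = -u := by rw [mul_assoc, h2, mul_neg_one]
  have c4 : u * h * u = h := by rw [mul_assoc, ha, mul_neg, c3, neg_neg]
  have c5 : u * h * (u * h) = -1 := by rw [← mul_assoc, c4, h2]
  have hcs : cos (τ : ℂ) ^ 2 + sin (τ : ℂ) ^ 2 = 1 := by rw [add_comm]; exact sin_sq_add_cos_sq _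
  have hXY : X.halfTurn.1 * Y.halfTurn.1 = -u := by
    rw [hX, hY]
    simp only [sub_mul, mul_add, smul_mul_assoc, mul_smul_comm, c1, c2, c5, h2]
    trans -((cos (τ : ℂ) ^ 2 + sin (τ : ℂ) ^ 2) • u)
    · module
    · rw [hcs, one_smul]
  have hYX : Y.halfTurn.1 * X.halfTurn.1 = u := by
    rw [hX, hY]
    simp only [mul_sub, add_mul, smul_mul_assoc, mul_smul_comm, c1, c2, c5, h2]
    trans (cos (τ : ℂ) ^ 2 + sin (τ : ℂ) ^ 2) • u
    · module
    · rw [hcs, one_smul]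
  have hXa : Y.halfTurn.1 * X.halfTurn.1 = -(X.halfTurn.1 * Y.halfTurn.1) := by
    rw [hXY, hYX, neg_neg]
  rw [halfTurn_map_val, mul_mul_inv_eq (a := cosh (d / 2)) (b := -(I * sinh (d / 2)))
    (by rw [X.trans_eq]; module) X.trace_halfTurn X.halfTurn_sq hXa]
  have e1 : cosh ((d : ℂ) / 2) ^ 2 - (-(I * sinh (d / 2))) ^ 2 = cosh d := by
    have := cosh_two_mul ((d : ℂ) / 2)
    rw [mul_div_cancel₀ _ two_ne_zero] at this
    rw [this]
    linear_combination -sinh ((d : ℂ) / 2) ^ 2 * I_sq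
  have e2 : 2 * cosh ((d : ℂ) / 2) * -(I * sinh (d / 2)) = -(I * sinh d) := by
    have := sinh_two_mul ((d : ℂ) / 2)
    rw [mul_div_cancel₀ _ two_ne_zero] at this
    rw [this]
    ring
  rw [e1, e2, add_mul, smul_mul_assoc, smul_mul_assoc, one_mul, hXY, hY]
  module

/-! ### The lines of a plane as a real hyperboloid. -/

lemma Line.Contains.mul_eq {X : Line} {p : H3} (h : X.Contains p) :
    X.halfTurn.1 * p.mat = -(p.mat * X.halfTurn.1ᴴ) := by
  have h1 := Line.contains_iff.mp h
  have h2 := congrArg (X.halfTurn.1 * ·) h1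
  simp only [← mul_assoc, X.halfTurn_sq] at h2
  rw [← h2]
  simp

lemma H3.isUnit_mat (p : H3) : IsUnit p.mat := by
  rw [isUnit_iff_isUnit_det, p.det_eq]; exact isUnit_one

lemma Plane.isUnit_mat (P : Plane) : IsUnit P.mat := by
  rw [isUnit_iff_isUnit_det, P.det_eq_neg_scale_sq, isUnit_iff_ne_zero]
  simp [P.scale_pos.ne']

/-- Self-adjointness carries h through Q, the scalar Q u p lets hᴴ pass to the right, and returning
through p costs a sign because p lies on L. -/
lemma Plane.IsNormalAt.anticommute {P : Plane} {L V : Line} {p : H3} (hV : P.IsNormalAt p V)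
    (hL : L.LiesOn P) (hp : L.Contains p) :
    L.halfTurn.1 * V.halfTurn.1 = -(V.halfTurn.1 * L.halfTurn.1) := by
  have h1 := (Plane.isNormalAt_iff (hL.trace_eq_zero hp)).mp hV
  have h2 := Line.liesOn_iff.mp hL
  have h3 := hp.mul_eq
  rw [← P.isUnit_mat.mul_right_inj, ← p.isUnit_mat.mul_left_inj]
  calc P.mat * (L.halfTurn.1 * V.halfTurn.1) * p.mat
      = P.mat * L.halfTurn.1 * V.halfTurn.1 * p.mat := by simp only [mul_assoc]
    _ = L.halfTurn.1ᴴ * (P.mat * V.halfTurn.1 * p.mat) := by rw [h2]; simp only [mul_assoc]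
    _ = (P.mat * V.halfTurn.1 * p.mat) * L.halfTurn.1ᴴ := by
      rw [h1, mul_smul_comm, mul_one, smul_mul_assoc, one_mul]
    _ = P.mat * V.halfTurn.1 * (p.mat * L.halfTurn.1ᴴ) := by simp only [mul_assoc]
    _ = P.mat * V.halfTurn.1 * -(L.halfTurn.1 * p.mat) := by rw [h3, neg_neg]
    _ = _ := by simp only [mul_assoc, mul_neg, neg_mul]

/-- The normal is anti-self-adjoint for the form of the plane. Multiplication by i repairs this,
which explains the factor i in the third coordinate. -/
lemma Plane.IsNormalAt.mul_eq {P : Plane} {V : Line} {p : H3} (hV : P.IsNormalAt p V)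
    (h0 : (P.mat * p.mat).trace = 0) :
    P.mat * V.halfTurn.1 = -(V.halfTurn.1ᴴ * P.mat) := by
  have h1 := (Plane.isNormalAt_iff h0).mp hV
  have h3 := hV.1.mul_eq
  have h4 := congrArg conjTranspose h1
  rw [conjTranspose_mul, conjTranspose_mul, P.mat_isHermitian.eq, p.posDef.1.eq] at h4
  rw [← p.isUnit_mat.mul_right_inj, mul_neg, h4]
  rw [← p.isUnit_mat.mul_left_inj, mul_assoc, h1]
  simp

lemma Plane.liesOn_of_coordinates {P : Plane} {L V N : Line} {p : H3} (hV : P.IsNormalAt p V)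
    (hL : L.LiesOn P) (hp : L.Contains p) {x y z : ℝ}
    (hN : N.halfTurn.1 = (x : ℂ) • L.halfTurn.1 + (y : ℂ) • (V.halfTurn.1 * L.halfTurn.1) +
      (I * z) • V.halfTurn.1) : N.LiesOn P := by
  have h1 := Line.liesOn_iff.mp hL
  have h2 := hV.mul_eq (hL.trace_eq_zero hp)
  have h3 : P.mat * (V.halfTurn.1 * L.halfTurn.1) =
      (V.halfTurn.1 * L.halfTurn.1)ᴴ * P.mat := by
    rw [← mul_assoc, h2, neg_mul, mul_assoc, h1, ← mul_assoc, ← conjTranspose_mul,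
      hV.anticommute hL hp, conjTranspose_neg, neg_mul, neg_neg]
  rw [Line.liesOn_iff, hN]
  simp only [mul_add, add_mul, conjTranspose_add, conjTranspose_smul, mul_smul_comm,
    smul_mul_assoc, h1, h2, h3]
  simp

/-- The product mn is similar, via Q, to (nm)ᴴ, and mn and nm have equal traces. -/
lemma star_trace_mul_of_selfAdjoint {Q m n : Matrix (Fin 2) (Fin 2) ℂ} (hQ : IsUnit Q)
    (hm : Q * m = mᴴ * Q) (hn : Q * n = nᴴ * Q) : star (m * n).trace = (m * n).trace := by
  have h1 : Q * (m * n) = (n * m)ᴴ * Q := by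
    rw [← mul_assoc, hm, mul_assoc, hn, ← mul_assoc, conjTranspose_mul]
  have hdet := (isUnit_iff_isUnit_det _).mp hQ
  calc star (m * n).trace = ((n * m)ᴴ).trace := by
        rw [trace_conjTranspose, trace_mul_comm]
    _ = (Q⁻¹ * ((n * m)ᴴ * Q)).trace := by
        rw [trace_mul_comm, mul_nonsing_inv_cancel_right _ _ hdet]
    _ = (m * n).trace := by rw [← h1, nonsing_inv_mul_cancel_left _ _ hdet]

/-- The frame coefficients are traces of products of self-adjoint matrices, hence real. The minus
sign in the quadric comes from (iz)². -/
lemma Plane.exists_coordinates {P : Plane} {L V N : Line} {p : H3} (hV : P.IsNormalAt p V)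
    (hL : L.LiesOn P) (hp : L.Contains p) (hN : N.LiesOn P) :
    ∃ x y z : ℝ, x ^ 2 + y ^ 2 - z ^ 2 = 1 ∧
      N.halfTurn.1 = (x : ℂ) • L.halfTurn.1 + (y : ℂ) • (V.halfTurn.1 * L.halfTurn.1) +
      (I * z) • V.halfTurn.1 := by
  have h1 := Line.liesOn_iff.mp hL
  have h2 := hV.mul_eq (hL.trace_eq_zero hp)
  have h3 : P.mat * (V.halfTurn.1 * L.halfTurn.1) =
      (V.halfTurn.1 * L.halfTurn.1)ᴴ * P.mat := by
    rw [← mul_assoc, h2, neg_mul, mul_assoc, h1, ← mul_assoc, ← conjTranspose_mul,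
      hV.anticommute hL hp, conjTranspose_neg, neg_mul, neg_neg]
  have h4 : P.mat * (I • V.halfTurn.1) = (I • V.halfTurn.1)ᴴ * P.mat := by
    rw [conjTranspose_smul, mul_smul_comm, h2]; simp
  have h5 := Line.liesOn_iff.mp hN
  have r1 := conj_eq_iff_re.mp (star_trace_mul_of_selfAdjoint P.isUnit_mat h1 h5)
  have r2 := conj_eq_iff_re.mp (star_trace_mul_of_selfAdjoint P.isUnit_mat h3 h5)
  have r3 := conj_eq_iff_re.mp (star_trace_mul_of_selfAdjoint P.isUnit_mat h4 h5)
  have ha := hV.anticommute hL hp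
  have key := traceless_expansion L.trace_halfTurn V.trace_halfTurn L.halfTurn_sq V.halfTurn_sq ha
    N.trace_halfTurn
  set X := (L.halfTurn.1 * N.halfTurn.1).trace.re
  set Y := (V.halfTurn.1 * L.halfTurn.1 * N.halfTurn.1).trace.re
  set Z := (I • V.halfTurn.1 * N.halfTurn.1).trace.re
  have r3' : (V.halfTurn.1 * N.halfTurn.1).trace = -I * Z := by
    rw [r3, smul_mul_assoc, trace_smul, smul_eq_mul, ← mul_assoc, neg_mul, I_mul_I, neg_neg,
      one_mul]
  rw [← r1, ← r2, r3'] at key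
  have key' : N.halfTurn.1 = ((-X / 2 : ℝ) : ℂ) • L.halfTurn.1 +
      ((-Y / 2 : ℝ) : ℂ) • (V.halfTurn.1 * L.halfTurn.1) +
      (I * ((Z / 2 : ℝ) : ℂ)) • V.halfTurn.1 := by
    refine key.trans ?_
    push_cast
    module
  refine ⟨_, _, _, ?_, key'⟩
  have := sq_coordinates L.halfTurn_sq V.halfTurn_sq ha key' N.halfTurn_sq
  rw [mul_pow, I_sq] at this
  have h6 : (((-X / 2) ^ 2 + (-Y / 2) ^ 2 - (Z / 2) ^ 2 : ℝ) : ℂ) = 1 := by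
    rw [← this]; push_cast; ring
  exact_mod_cast h6

/-- Take d = arsinh z and τ = arg(x + iy); the quadric says |x + iy| = √(1 + z²) = cosh d. -/
lemma exists_polar_parameters {x y z : ℝ} (h : x ^ 2 + y ^ 2 - z ^ 2 = 1) (hz : 0 ≤ z) :
    ∃ d τ : ℝ, 0 ≤ d ∧ -Real.pi < τ ∧ τ ≤ Real.pi ∧ Real.cosh d * Real.cos τ = x ∧
      Real.cosh d * Real.sin τ = y ∧ Real.sinh d = z := by
  have hn : ‖(⟨x, y⟩ : ℂ)‖ = Real.cosh (Real.arsinh z) := by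
    rw [Real.cosh_arsinh, norm_def, normSq_mk]
    congr 1
    linear_combination h
  refine ⟨Real.arsinh z, arg ⟨x, y⟩, Real.arsinh_nonneg_iff.mpr hz, neg_pi_lt_arg _,
    arg_le_pi _, ?_, ?_, Real.sinh_arsinh z⟩
  · rw [← hn, norm_mul_cos_arg]
  · rw [← hn, norm_mul_sin_arg]

lemma IsMove.liesOn {P : Plane} {L N : Line} {v : H3} {d τ : ℝ} (h : IsMove P L v d τ N)
    (hL : L.LiesOn P) (hv : L.Contains v) : N.LiesOn P := by
  obtain ⟨V, hV, rfl⟩ := h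
  refine Plane.liesOn_of_coordinates hV hL hv (x := Real.cosh d * Real.cos τ)
    (y := Real.cosh d * Real.sin τ) (z := Real.sinh d) ?_
  rw [halfTurn_move (hV.anticommute hL hv)]
  push_cast
  rfl

/-- Every line of a plane is, up to orientation, obtained by a move. -/
lemma exists_isMove {P : Plane} {L N : Line} {v : H3} (hL : L.LiesOn P) (hv : L.Contains v)
    (hN : N.LiesOn P) :
    ∃ (d τ : ℝ) (N' : Line), 0 ≤ d ∧ -Real.pi < τ ∧ τ ≤ Real.pi ∧ IsMove P L v d τ N' ∧
      (N'.halfTurn = N.halfTurn ∨ N'.halfTurn = -N.halfTurn) := by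
  obtain ⟨V, hV⟩ := Plane.exists_isNormalAt (hL.trace_eq_zero hv)
  obtain ⟨x, y, z, h1, h2⟩ := Plane.exists_coordinates hV hL hv hN
  have ha := hV.anticommute hL hv
  rcases le_total 0 z with hz | hz
  · obtain ⟨d, τ, hd, ht, ht', e1, e2, e3⟩ := exists_polar_parameters h1 hz
    refine ⟨d, τ, _, hd, ht, ht', ⟨V, hV, rfl⟩, Or.inl (Subtype.ext ?_)⟩
    rw [halfTurn_move ha, h2, ← e1, ← e2, ← e3]
    push_cast
    rfl
  -- Non-negative d reaches only z ≥ 0, so for negative z the reversed line is produced.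
  · obtain ⟨d, τ, hd, ht, ht', e1, e2, e3⟩ :=
      exists_polar_parameters (x := -x) (y := -y) (z := -z) (by linear_combination h1)
        (neg_nonneg.mpr hz)
    refine ⟨d, τ, _, hd, ht, ht', ⟨V, hV, rfl⟩, Or.inr (Subtype.ext ?_)⟩
    rw [halfTurn_move ha, SpecialLinearGroup.coe_neg, h2, ← neg_neg x, ← neg_neg y, ← neg_neg z,
      ← e1, ← e2, ← e3]
    push_cast
    module

/-! ### Axes, base points and ortho-ends -/

lemma sqrt_sq_eq (x : ℂ) : (x ^ (1 / 2 : ℂ)) ^ 2 = x := by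
  rw [one_div, cpow_ofNat_inv_pow]

lemma sqrt_ne_zero_of_ne_zero {x : ℂ} (hx : x ≠ 0) : x ^ (1 / 2 : ℂ) ≠ 0 := by
  intro h
  apply hx
  rw [← sqrt_sq_eq x, h]
  simp

lemma sqrt_sq_of_pos {r : ℝ} (hr : 0 < r) : ((r : ℂ) ^ 2) ^ (1 / 2 : ℂ) = r := by
  rw [one_div, sq_cpow_two_inv (by simpa using hr)]

/-- The traceless part of a matrix. -/
noncomputable def tracelessPart (M : Matrix (Fin 2) (Fin 2) ℂ) : Matrix (Fin 2) (Fin 2) ℂ :=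
  M - (M.trace / 2) • 1

/-- The ends are eigenvectors of A. Equal eigenvalues would make A scalar and fix the whole infinite
sphere, hence c ≠ 0. -/
lemma IsAxis.exists_tracelessPart_eq {A : SL(2, ℂ)} {X : Line} (h : IsAxis A X) :
    ∃ c : ℂ, c ≠ 0 ∧ tracelessPart A.1 = c • X.halfTurn.1 := by
  have hs : moeb A X.src = X.src := by
    have : X.src ∈ {z | moeb A z = z} := by rw [h]; simp
    exact this
  have ht : moeb A X.tgt = X.tgt := by
    have : X.tgt ∈ {z | moeb A z = z} := by rw [h]; simp
    exact this
  obtain ⟨l, hl⟩ := (moeb_eq_iff _ _ _).mp hs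
  obtain ⟨k, hk⟩ := (moeb_eq_iff _ _ _).mp ht
  have hA : A.1 = (-I * ((k - l) / 2)) • X.halfTurn.1 + ((k + l) / 2) • 1 := by
    apply eq_of_mulVec_tgt_src X
    · rw [hk, add_mulVec, smul_mulVec, smul_mulVec, one_mulVec, X.halfTurn_mulVec_tgt, smul_smul,
        ← add_smul]
      congr 1
      linear_combination (k - l) / 2 * I_mul_I
    · rw [hl, add_mulVec, smul_mulVec, smul_mulVec, one_mulVec, X.halfTurn_mulVec_src, smul_smul,
        ← add_smul]
      congr 1
      linear_combination -(k - l) / 2 * I_mul_I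
  have htr : A.1.trace = k + l := by
    rw [hA, trace_add, trace_smul, trace_smul, X.trace_halfTurn]
    simp
  refine ⟨-I * ((k - l) / 2), ?_, ?_⟩
  · intro h0
    rw [h0, zero_smul, zero_add] at hA
    have huniv : ({X.src, X.tgt} : Set (OnePoint ℂ)) = Set.univ := by
      rw [← h, Set.eq_univ_iff_forall]
      intro z
      refine (moeb_eq_iff _ _ _).mpr ⟨(k + l) / 2, ?_⟩
      rw [hA, smul_mulVec, one_mulVec]
    have : Infinite (OnePoint ℂ) := Infinite.of_injective _ OnePoint.coe_injective
    exact Set.infinite_univ (huniv.symm ▸ Set.toFinite ({X.src, X.tgt} : Set (OnePoint ℂ)))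
  · rw [tracelessPart, htr, hA, add_sub_cancel_right]

lemma Line.halfTurn_eq_or_neg_of_smul {X Y : Line} {c : ℂ}
    (h : Y.halfTurn.1 = c • X.halfTurn.1) :
    Y.halfTurn.1 = X.halfTurn.1 ∨ Y.halfTurn.1 = -X.halfTurn.1 := by
  have h1 := Y.halfTurn.2
  rw [h, det_smul, X.halfTurn.2, Fintype.card_fin, mul_one] at h1
  rcases mul_self_eq_one_iff.mp ((sq c).symm.trans h1) with rfl | rfl
  · left; rw [h, one_smul]
  · right; rw [h, neg_one_smul]

lemma IsAxis.halfTurn_eq_or_neg {A : SL(2, ℂ)} {X Y : Line} (hX : IsAxis A X) (hY : IsAxis A Y) :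
    Y.halfTurn.1 = X.halfTurn.1 ∨ Y.halfTurn.1 = -X.halfTurn.1 := by
  obtain ⟨c, -, h1⟩ := hX.exists_tracelessPart_eq
  obtain ⟨c', h0, h2⟩ := hY.exists_tracelessPart_eq
  apply Line.halfTurn_eq_or_neg_of_smul (c := c'⁻¹ * c)
  rw [mul_smul, ← h1, h2, smul_smul, inv_mul_cancel₀ h0, one_smul]

/-- The half-turn about the axis of `A`, up to sign, as an expression in `A`. -/
noncomputable def axisTurn (A : Matrix (Fin 2) (Fin 2) ℂ) : Matrix (Fin 2) (Fin 2) ℂ :=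
  ((tracelessPart A).det ^ (1 / 2 : ℂ))⁻¹ • tracelessPart A

/-- The determinant is c², so its principal root is c or −c, and only a sign is lost. -/
lemma sqrt_inv_smul_eq {M : Matrix (Fin 2) (Fin 2) ℂ} {X : Line} {c : ℂ} (hc : c ≠ 0)
    (h : M = c • X.halfTurn.1) :
    M.det ≠ 0 ∧ ((M.det ^ (1 / 2 : ℂ))⁻¹ • M = X.halfTurn.1 ∨
      (M.det ^ (1 / 2 : ℂ))⁻¹ • M = -X.halfTurn.1) := by
  have hd : M.det = c ^ 2 := by
    rw [h, det_smul, X.halfTurn.2, Fintype.card_fin, mul_one]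
  have hd0 : M.det ≠ 0 := by rw [hd]; exact pow_ne_zero 2 hc
  refine ⟨hd0, ?_⟩
  have h2 := sqrt_sq_eq M.det
  rw [hd] at h2 ⊢
  rcases sq_eq_sq_iff_eq_or_eq_neg.mp h2 with h3 | h3 <;> rw [h3, h, smul_smul]
  · left; rw [inv_mul_cancel₀ hc, one_smul]
  · right; rw [inv_neg, neg_mul, inv_mul_cancel₀ hc, neg_one_smul]

lemma IsAxis.axisTurn_eq_or_neg {A : SL(2, ℂ)} {X : Line} (hX : IsAxis A X) :
    (tracelessPart A.1).det ≠ 0 ∧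
      (axisTurn A.1 = X.halfTurn.1 ∨ axisTurn A.1 = -X.halfTurn.1) := by
  obtain ⟨c, hc, h⟩ := hX.exists_tracelessPart_eq
  exact sqrt_inv_smul_eq hc h

/-- The sum of `g gᴴ` over the quaternion group generated by `h` and `u` modulo its centre. -/
def quaternionSum (h u : Matrix (Fin 2) (Fin 2) ℂ) : Matrix (Fin 2) (Fin 2) ℂ :=
  1 + h * hᴴ + u * uᴴ + h * u * (h * u)ᴴ

/-- Makes the unknown sign of the axis half-turn harmless. -/
lemma quaternionSum_neg_right (h u : Matrix (Fin 2) (Fin 2) ℂ) :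
    quaternionSum h (-u) = quaternionSum h u := by
  simp [quaternionSum]

lemma quaternionSum_posDef (h u : Matrix (Fin 2) (Fin 2) ℂ) : (quaternionSum h u).PosDef :=
  ((PosDef.one.add_posSemidef (posSemidef_self_mul_conjTranspose h)).add_posSemidef
    (posSemidef_self_mul_conjTranspose u)).add_posSemidef
      (posSemidef_self_mul_conjTranspose (h * u))

lemma H3.trace_pos (p : H3) : 0 < p.mat.trace.re ∧ p.mat.trace = (p.mat.trace.re : ℂ) := by
  have h := p.posDef.trace_pos
  rw [pos_iff] at h
  exact ⟨h.1, by apply Complex.ext <;> simp [h.2]⟩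

lemma H3.mul_adjugate (p : H3) : p.mat * p.mat.adjugate = 1 := by
  rw [Matrix.mul_adjugate, p.det_eq, one_smul]

lemma H3.adjugate_mul (p : H3) : p.mat.adjugate * p.mat = 1 := by
  rw [Matrix.adjugate_mul, p.det_eq, one_smul]

/-- For each m in the group, m v = ±v mᴴ turns m mᴴ into ±(m v⁻¹ m) v. The sum is thus the
quaternion average of v⁻¹, which is scalar, times v; determinant one gives v⁻¹ the trace of v. -/
lemma quaternionSum_eq {L X : Line} {v : H3} (hL : L.Contains v) (hX : X.Contains v)
    (ha : L.halfTurn.1 * X.halfTurn.1 = -(X.halfTurn.1 * L.halfTurn.1)) :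
    quaternionSum L.halfTurn.1 X.halfTurn.1 = (2 * v.mat.trace) • v.mat := by
  set h := L.halfTurn.1
  set u := X.halfTurn.1
  have key : ∀ {m : Matrix (Fin 2) (Fin 2) ℂ}, m * v.mat = -(v.mat * mᴴ) →
      m * mᴴ = -(m * v.mat.adjugate * m * v.mat) := by
    intro m hm
    have : mᴴ = -(v.mat.adjugate * m * v.mat) := by
      rw [mul_assoc, hm, mul_neg, neg_neg, ← mul_assoc, v.adjugate_mul, one_mul]
    nth_rewrite 1 [this]
    simp only [mul_neg, mul_assoc]
  have h1 := hL.mul_eq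
  have h2 := hX.mul_eq
  have h3 : h * u * v.mat = -(v.mat * (h * u)ᴴ) := by
    rw [mul_assoc, h2, mul_neg, ← mul_assoc, h1, neg_mul, neg_neg, ha, conjTranspose_neg, mul_neg,
      neg_neg, conjTranspose_mul, mul_assoc]
  have hav := quaternion_average (K := v.mat.adjugate) L.trace_halfTurn L.halfTurn_sq X.halfTurn_sq ha
  have ht : v.mat.adjugate.trace = v.mat.trace := by
    simp [trace_fin_two, adjugate_fin_two, add_comm]
  rw [ht] at hav
  have := congrArg (· * v.mat) hav
  simp only [sub_mul, v.adjugate_mul, smul_mul_assoc, one_mul] at this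
  rw [← this, quaternionSum, key h1, key h2, key h3]
  simp only [mul_assoc]
  abel

/-- The intersection point of two orthogonal lines in terms of their half-turns. -/
lemma mat_eq_of_contains {L X : Line} {v : H3} (hL : L.Contains v) (hX : X.Contains v)
    (ha : L.halfTurn.1 * X.halfTurn.1 = -(X.halfTurn.1 * L.halfTurn.1)) :
    (quaternionSum L.halfTurn.1 X.halfTurn.1).det ≠ 0 ∧
    v.mat = ((quaternionSum L.halfTurn.1 X.halfTurn.1).det ^ (1 / 2 : ℂ))⁻¹ •
      quaternionSum L.halfTurn.1 X.halfTurn.1 := by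
  obtain ⟨h1, h2⟩ := v.trace_pos
  have h3 : 2 * v.mat.trace = ((2 * v.mat.trace.re : ℝ) : ℂ) := by rw [h2]; push_cast; simp
  have hne : ((2 * v.mat.trace.re : ℝ) : ℂ) ≠ 0 := by
    exact_mod_cast (mul_pos two_pos h1).ne'
  have hd : (quaternionSum L.halfTurn.1 X.halfTurn.1).det =
      ((2 * v.mat.trace.re : ℝ) : ℂ) ^ 2 := by
    rw [quaternionSum_eq hL hX ha, det_smul, v.det_eq, Fintype.card_fin, mul_one, h3]
  refine ⟨by rw [hd]; exact pow_ne_zero 2 hne, ?_⟩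
  rw [hd, sqrt_sq_of_pos (mul_pos two_pos h1), quaternionSum_eq hL hX ha, h3, smul_smul,
    inv_mul_cancel₀ hne, one_smul]

/-- Conjugation by either half-turn permutes the four terms of the quaternion sum, so its
normalisation to determinant one is a point fixed by both. -/
lemma exists_contains {L X : Line}
    (ha : L.halfTurn.1 * X.halfTurn.1 = -(X.halfTurn.1 * L.halfTurn.1)) :
    ∃ v, L.Contains v ∧ X.Contains v := by
  set h := L.halfTurn.1 with hh
  set u := X.halfTurn.1 with hu
  have h2 : h * h = -1 := L.halfTurn_sq
  have u2 : u * u = -1 := X.halfTurn_sq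
  have h2' : hᴴ * hᴴ = -1 := by rw [← conjTranspose_mul, h2]; simp
  have u2' : uᴴ * uᴴ = -1 := by rw [← conjTranspose_mul, u2]; simp
  have hq := quaternionSum_posDef h u
  have hdet := hq.det_pos
  rw [pos_iff] at hdet
  set q := quaternionSum h u with hqd
  have hre : q.det = (q.det.re : ℂ) := by apply Complex.ext <;> simp [hdet.2]
  have hs := Real.sqrt_pos.mpr hdet.1
  let v : H3 :=
    { mat := (((Real.sqrt q.det.re)⁻¹ : ℝ) : ℂ) • q
      posDef := hq.smul (by exact_mod_cast inv_pos.mpr hs)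
      det_eq := by
        rw [det_smul, Fintype.card_fin, hre, ← ofReal_pow, ← ofReal_mul, inv_pow,
          ofReal_re, Real.sq_sqrt hdet.1.le]
        simp [hdet.1.ne'] }
  have key : ∀ {m : Matrix (Fin 2) (Fin 2) ℂ}, m * q * mᴴ = q → m * v.mat * mᴴ = v.mat := by
    intro m hm
    change m * (_ • q) * mᴴ = _ • q
    rw [mul_smul_comm, smul_mul_assoc, hm]
  refine ⟨v, Line.contains_iff.mpr (key ?_), Line.contains_iff.mpr (key ?_)⟩
  · have e1 : h * (h * hᴴ) * hᴴ = 1 := by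
      rw [← mul_assoc, h2, mul_assoc, neg_one_mul, h2', neg_neg]
    have e2 : h * (u * uᴴ) * hᴴ = h * u * (h * u)ᴴ := by
      rw [conjTranspose_mul]; simp only [mul_assoc]
    have e3 : h * (h * u * (h * u)ᴴ) * hᴴ = u * uᴴ := by
      have : h * (h * u) = -u := by rw [← mul_assoc, h2, neg_one_mul]
      rw [← mul_assoc h, this, mul_assoc, ← conjTranspose_mul, this]
      simp
    rw [hqd, quaternionSum]
    simp only [mul_add, add_mul, mul_one]
    rw [← hh, e1, e2, e3]
    abel
  · have hua : u * h = -(h * u) := by rw [ha, neg_neg]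
    have e1 : u * (u * uᴴ) * uᴴ = 1 := by
      rw [← mul_assoc, u2, mul_assoc, neg_one_mul, u2', neg_neg]
    have e2 : u * (h * hᴴ) * uᴴ = h * u * (h * u)ᴴ := by
      have : u * (h * hᴴ) * uᴴ = u * h * (u * h)ᴴ := by
        rw [conjTranspose_mul]; simp only [mul_assoc]
      rw [this, hua]
      simp
    have e3 : u * (h * u * (h * u)ᴴ) * uᴴ = h * hᴴ := by
      have : u * (h * u) = h := by rw [ha, mul_neg, ← mul_assoc, u2, neg_one_mul, neg_neg]
      rw [← mul_assoc u, this, mul_assoc, ← conjTranspose_mul, this]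
    rw [hqd, quaternionSum]
    simp only [mul_add, add_mul, mul_one]
    rw [← hu, e1, e2, e3]
    abel

/-- A commutes with the half-turn about its axis, while the factor from L anticommutes with it; so
must the other factor. -/
lemma anticommute_axis {A : SL(2, ℂ)} {X L M : Line} (hX : IsAxis A X) (hL : L.Perp X)
    (hA : A = M.halfTurn * L.halfTurn ∨ A = -(M.halfTurn * L.halfTurn)) :
    M.halfTurn.1 * X.halfTurn.1 = -(X.halfTurn.1 * M.halfTurn.1) := by
  obtain ⟨c, -, hc⟩ := hX.exists_tracelessPart_eq
  have hA' : A.1 = c • X.halfTurn.1 + (A.1.trace / 2) • 1 := by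
    rw [← hc, tracelessPart, sub_add_cancel]
  have hcomm : A.1 * X.halfTurn.1 = X.halfTurn.1 * A.1 := by
    rw [hA']; simp [add_mul, mul_add]
  have hW : M.halfTurn.1 * L.halfTurn.1 * X.halfTurn.1 =
      X.halfTurn.1 * (M.halfTurn.1 * L.halfTurn.1) := by
    rcases hA with h | h <;> rw [h] at hcomm
    · exact hcomm
    · simpa using hcomm
  have hM : M.halfTurn.1 = -(M.halfTurn.1 * L.halfTurn.1 * L.halfTurn.1) := by
    rw [mul_assoc, L.halfTurn_sq]; simp
  have hp := hL.anticommute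
  rw [hM, neg_mul, mul_assoc, hp, mul_neg, ← mul_assoc, hW, neg_neg]
  simp only [mul_neg, neg_neg, mul_assoc]

/-- The commutator `A B - B A` as a multiple of the half-turn about the common perpendicular. -/
lemma exists_commutator_eq {A B : SL(2, ℂ)} {XA XB L : Line} (hA : IsAxis A XA)
    (hB : IsAxis B XB) (hne : ¬ XA.SameUnoriented XB) (h1 : L.Perp XA) (h2 : L.Perp XB) :
    ∃ c : ℂ, c ≠ 0 ∧ A.1 * B.1 - B.1 * A.1 = c • L.halfTurn.1 := by
  obtain ⟨a, ha, ha'⟩ := hA.exists_tracelessPart_eq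
  obtain ⟨b, hb, hb'⟩ := hB.exists_tracelessPart_eq
  have hA' : A.1 = a • XA.halfTurn.1 + (A.1.trace / 2) • 1 := by
    rw [← ha', tracelessPart, sub_add_cancel]
  have hB' : B.1 = b • XB.halfTurn.1 + (B.1.trace / 2) • 1 := by
    rw [← hb', tracelessPart, sub_add_cancel]
  have hC : A.1 * B.1 - B.1 * A.1 =
      (a * b) • (XA.halfTurn.1 * XB.halfTurn.1 - XB.halfTurn.1 * XA.halfTurn.1) := by
    rw [hA', hB']
    simp only [mul_add, add_mul, smul_mul_assoc, mul_smul_comm, one_mul, mul_one]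
    module
  have p1 := h1.anticommute
  have p2 := h2.anticommute
  have q1 : L.halfTurn.1 * (XA.halfTurn.1 * XB.halfTurn.1) =
      XA.halfTurn.1 * XB.halfTurn.1 * L.halfTurn.1 := by
    rw [← mul_assoc, p1, neg_mul, mul_assoc, p2, mul_neg, neg_neg, mul_assoc]
  have q2 : L.halfTurn.1 * (XB.halfTurn.1 * XA.halfTurn.1) =
      XB.halfTurn.1 * XA.halfTurn.1 * L.halfTurn.1 := by
    rw [← mul_assoc, p2, neg_mul, mul_assoc, p1, mul_neg, neg_neg, mul_assoc]
  -- The half-turn about L anticommutes with each axis half-turn, hence commutes with their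
  -- products. If c were 0, the axis half-turns would commute and the axes would coincide.
  obtain ⟨c, hc⟩ := exists_eq_smul_of_commute (N := A.1 * B.1 - B.1 * A.1) L.trace_halfTurn
    (by rw [trace_sub, trace_mul_comm, sub_self]) L.halfTurn_sq
    (by rw [hC, mul_smul_comm, smul_mul_assoc, mul_sub, sub_mul, q1, q2])
  refine ⟨c, ?_, hc⟩
  rintro rfl
  rw [zero_smul, hC, smul_eq_zero] at hc
  obtain ⟨k, hk⟩ := exists_eq_smul_of_commute XA.trace_halfTurn XB.trace_halfTurn XA.halfTurn_sq
    (sub_eq_zero.mp (hc.resolve_left (mul_ne_zero ha hb)))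
  exact hne (Line.sameUnoriented_of_halfTurn_eq_smul hk)

/-- The half-turn about the common perpendicular, up to sign, as an expression in `A` and `B`. -/
noncomputable def perpTurn (A B : Matrix (Fin 2) (Fin 2) ℂ) : Matrix (Fin 2) (Fin 2) ℂ :=
  ((A * B - B * A).det ^ (1 / 2 : ℂ))⁻¹ • (A * B - B * A)

/-- The signs that record the orientations of the lines of an ortho-end. -/
structure IsSigns (A B : SL(2, ℂ)) (L : Mark → Line) (s : Mark → ℤˣ) : Prop where
  det_ne : (A.1 * B.1 - B.1 * A.1).det ≠ 0
  perp : (L .d).halfTurn.1 = ((s .d : ℤ) : ℂ) • perpTurn A.1 B.1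
  left : A.1 = ((s .a : ℤ) : ℂ) • ((L .a).halfTurn.1 * (L .d).halfTurn.1)
  right : B.1 = ((s .b : ℤ) : ℂ) • ((L .b).halfTurn.1 * (L .d).halfTurn.1)

lemma IsOrthoEnd.exists_isSigns {A B : SL(2, ℂ)} {L : Mark → Line} (h : IsOrthoEnd A B L) :
    ∃ s, IsSigns A B L s := by
  obtain ⟨⟨XA, XB, hA, hB, hne, h1, h2⟩, hl, hr⟩ := h
  obtain ⟨c, hc, hC⟩ := exists_commutator_eq hA hB hne h1 h2
  obtain ⟨hdet, hd⟩ := sqrt_inv_smul_eq hc hC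
  have hd' : ∃ e : ℤˣ, (L .d).halfTurn.1 = ((e : ℤ) : ℂ) • perpTurn A.1 B.1 := by
    rcases hd with hd | hd
    · exact ⟨1, by rw [perpTurn, hd]; simp⟩
    · exact ⟨-1, by rw [perpTurn, hd]; simp⟩
  have key : ∀ {M N : SL(2, ℂ)}, (M = N ∨ M = -N) → ∃ e : ℤˣ, M.1 = ((e : ℤ) : ℂ) • N.1 := by
    rintro M N (rfl | rfl)
    · exact ⟨1, by simp⟩
    · exact ⟨-1, by simp⟩
  obtain ⟨e, he⟩ := hd'
  obtain ⟨ea, hea⟩ := key hl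
  obtain ⟨eb, heb⟩ := key hr
  exact ⟨fun | .a => ea | .d => e | .b => eb, hdet, he, hea, heb⟩

/-- Since W ≠ −W, the sign relating A to W is unique and is the one carried over to A'. -/
lemma SameLift.val_eq {A W A' W' : SL(2, ℂ)} {e : ℤˣ} (h : SameLift A W A' W')
    (hA : A.1 = ((e : ℤ) : ℂ) • W.1) : A'.1 = ((e : ℤ) : ℂ) • W'.1 := by
  have hne : W.1 ≠ -W.1 := by
    intro h0
    have h1 : W.1 = 0 := by
      ext i j
      have := congrFun (congrFun h0 i) j
      simp only [Matrix.neg_apply] at this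
      simpa using self_eq_neg.mp this
    have := W.2
    rw [h1] at this
    simp at this
  rcases Int.units_eq_one_or e with rfl | rfl <;> rcases h with ⟨rfl, rfl⟩ | ⟨rfl, rfl⟩
  · simp
  · simp at hA
    exact absurd hA.symm hne
  · simp at hA
    exact absurd hA hne
  · simp

/-! ### Functions given by explicit elementary expressions -/

section Elementary

variable {D ι : Type} {φ : D → ι → ℂ} {F G : D → ℂ} {M N : D → Matrix (Fin 2) (Fin 2) ℂ}

/-- The function `G` of the data is the value of one well-defined expression in the inputs. -/
def IsElem (φ : D → ι → ℂ) (G : D → ℂ) : Prop := ∃ e : Expr ι, ∀ x, e.Computes (φ x) (G x)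

lemma IsElem.congr (h : IsElem φ F) (e : ∀ x, G x = F x) : IsElem φ G := by
  rwa [show G = F from funext e]

lemma isElem_var (i : ι) : IsElem φ (fun x => φ x i) := ⟨.var i, fun _ => ⟨trivial, rfl⟩⟩

lemma isElem_rat (q : ℚ) : IsElem φ (fun _ => (q : ℂ)) := ⟨.rat q, fun _ => ⟨trivial, rfl⟩⟩

lemma isElem_I : IsElem φ (fun _ => I) := ⟨.imag, fun _ => ⟨trivial, rfl⟩⟩

lemma IsElem.add (hF : IsElem φ F) (hG : IsElem φ G) : IsElem φ (fun x => F x + G x) := by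
  obtain ⟨e, he⟩ := hF
  obtain ⟨f, hf⟩ := hG
  exact ⟨.add e f, fun x => ⟨⟨(he x).1, (hf x).1⟩, by simp [Expr.eval, (he x).2, (hf x).2]⟩⟩

lemma IsElem.mul (hF : IsElem φ F) (hG : IsElem φ G) : IsElem φ (fun x => F x * G x) := by
  obtain ⟨e, he⟩ := hF
  obtain ⟨f, hf⟩ := hG
  exact ⟨.mul e f, fun x => ⟨⟨(he x).1, (hf x).1⟩, by simp [Expr.eval, (he x).2, (hf x).2]⟩⟩

lemma IsElem.neg (hF : IsElem φ F) : IsElem φ (fun x => -F x) := by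
  obtain ⟨e, he⟩ := hF
  exact ⟨.neg e, fun x => ⟨(he x).1, by simp [Expr.eval, (he x).2]⟩⟩

lemma IsElem.inv (hF : IsElem φ F) (h0 : ∀ x, F x ≠ 0) : IsElem φ (fun x => (F x)⁻¹) := by
  obtain ⟨e, he⟩ := hF
  exact ⟨.inv e, fun x => ⟨⟨(he x).1, by rw [(he x).2]; exact h0 x⟩, by
    simp [Expr.eval, (he x).2]⟩⟩

lemma IsElem.conj (hF : IsElem φ F) : IsElem φ (fun x => star (F x)) := by
  obtain ⟨e, he⟩ := hF
  exact ⟨.conj e, fun x => ⟨(he x).1, by simp [Expr.eval, (he x).2]⟩⟩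

lemma IsElem.sqrt (hF : IsElem φ F) : IsElem φ (fun x => F x ^ (1 / 2 : ℂ)) := by
  obtain ⟨e, he⟩ := hF
  exact ⟨.sqrt e, fun x => ⟨(he x).1, by simp [Expr.eval, (he x).2]⟩⟩

lemma IsElem.exp (hF : IsElem φ F) : IsElem φ (fun x => Complex.exp (F x)) := by
  obtain ⟨e, he⟩ := hF
  exact ⟨.exp e, fun x => ⟨(he x).1, by simp [Expr.eval, (he x).2]⟩⟩

lemma IsElem.sub (hF : IsElem φ F) (hG : IsElem φ G) : IsElem φ (fun x => F x - G x) :=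
  (hF.add hG.neg).congr fun _ => sub_eq_add_neg _ _

lemma IsElem.div_two (hF : IsElem φ F) : IsElem φ (fun x => F x / 2) :=
  (hF.mul (isElem_rat (1 / 2))).congr fun x => by push_cast; ring

lemma IsElem.cosh (hF : IsElem φ F) : IsElem φ (fun x => Complex.cosh (F x)) :=
  (hF.exp.add hF.neg.exp).div_two

lemma IsElem.sinh (hF : IsElem φ F) : IsElem φ (fun x => Complex.sinh (F x)) :=
  (hF.exp.sub hF.neg.exp).div_two

lemma IsElem.cos (hF : IsElem φ F) : IsElem φ (fun x => Complex.cos (F x)) :=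
  (hF.mul isElem_I).cosh.congr fun _ => (cosh_mul_I _).symm

lemma IsElem.sin (hF : IsElem φ F) : IsElem φ (fun x => Complex.sin (F x)) :=
  ((hF.mul isElem_I).sinh.mul isElem_I).neg.congr fun x => by
    rw [sinh_mul_I]; linear_combination Complex.sin (F x) * I_mul_I

/-- All entries of the matrix are explicit elementary functions of the inputs. -/
def IsElemMat (φ : D → ι → ℂ) (M : D → Matrix (Fin 2) (Fin 2) ℂ) : Prop :=
  ∀ i j, IsElem φ (fun x => M x i j)

lemma IsElemMat.congr (h : IsElemMat φ M) (e : ∀ x, N x = M x) : IsElemMat φ N := by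
  rwa [show N = M from funext e]

lemma isElemMat_one : IsElemMat φ (fun _ => 1) := by
  intro i j
  by_cases h : i = j
  · exact (isElem_rat 1).congr fun _ => by simp [one_apply, h]
  · exact (isElem_rat 0).congr fun _ => by simp [one_apply, h]

lemma IsElemMat.add (hM : IsElemMat φ M) (hN : IsElemMat φ N) :
    IsElemMat φ (fun x => M x + N x) := fun i j => (hM i j).add (hN i j)

lemma IsElemMat.neg (hM : IsElemMat φ M) : IsElemMat φ (fun x => -M x) := fun i j => (hM i j).neg

lemma IsElemMat.sub (hM : IsElemMat φ M) (hN : IsElemMat φ N) :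
    IsElemMat φ (fun x => M x - N x) := fun i j => (hM i j).sub (hN i j)

lemma IsElemMat.smul (hF : IsElem φ F) (hM : IsElemMat φ M) :
    IsElemMat φ (fun x => F x • M x) := fun i j => hF.mul (hM i j)

lemma IsElemMat.mul (hM : IsElemMat φ M) (hN : IsElemMat φ N) :
    IsElemMat φ (fun x => M x * N x) := fun i j =>
  (((hM i 0).mul (hN 0 j)).add ((hM i 1).mul (hN 1 j))).congr fun x => by
    simp only [mul_apply, Fin.sum_univ_two]

lemma IsElemMat.conjTranspose (hM : IsElemMat φ M) : IsElemMat φ (fun x => (M x)ᴴ) :=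
  fun i j => (hM j i).conj

lemma IsElemMat.trace (hM : IsElemMat φ M) : IsElem φ (fun x => (M x).trace) :=
  ((hM 0 0).add (hM 1 1)).congr fun _ => trace_fin_two _

lemma IsElemMat.det (hM : IsElemMat φ M) : IsElem φ (fun x => (M x).det) :=
  (((hM 0 0).mul (hM 1 1)).sub ((hM 0 1).mul (hM 1 0))).congr fun _ => det_fin_two _

lemma IsElemMat.adjugate (hM : IsElemMat φ M) : IsElemMat φ (fun x => (M x).adjugate) :=
  ((IsElemMat.smul hM.trace isElemMat_one).sub hM).congr fun x => by
    ext i j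
    fin_cases i <;> fin_cases j <;> simp [adjugate_fin_two, trace_fin_two]

lemma IsElemMat.inv_sqrt_det_smul (hM : IsElemMat φ M) (hN : IsElemMat φ N)
    (h0 : ∀ x, (M x).det ≠ 0) :
    IsElemMat φ (fun x => ((M x).det ^ (1 / 2 : ℂ))⁻¹ • N x) :=
  IsElemMat.smul (hM.det.sqrt.inv fun x => sqrt_ne_zero_of_ne_zero (h0 x)) hN

lemma IsElemMat.tracelessPart (hM : IsElemMat φ M) : IsElemMat φ (fun x => tracelessPart (M x)) :=
  hM.sub (IsElemMat.smul hM.trace.div_two isElemMat_one)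

lemma IsElemMat.quaternionSum (hM : IsElemMat φ M) (hN : IsElemMat φ N) :
    IsElemMat φ (fun x => quaternionSum (M x) (N x)) :=
  ((isElemMat_one.add (hM.mul hM.conjTranspose)).add (hN.mul hN.conjTranspose)).add
    ((hM.mul hN).mul (hM.mul hN).conjTranspose)

/-- The intersection point of a line with an axis. -/
lemma isElemMat_point {A : D → SL(2, ℂ)} {L X : D → Line} {v : D → H3}
    (hA : IsElemMat φ (fun x => (A x).1)) (hL : IsElemMat φ (fun x => (L x).halfTurn.1))
    (hX : ∀ x, IsAxis (A x) (X x))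
    (ha : ∀ x, (L x).halfTurn.1 * (X x).halfTurn.1 = -((X x).halfTurn.1 * (L x).halfTurn.1))
    (h1 : ∀ x, (L x).Contains (v x)) (h2 : ∀ x, (X x).Contains (v x)) :
    IsElemMat φ (fun x => (v x).mat) := by
  have h3 : IsElemMat φ (fun x => axisTurn (A x).1) :=
    hA.tracelessPart.inv_sqrt_det_smul hA.tracelessPart fun x => (hX x).axisTurn_eq_or_neg.1
  -- The computed axis half-turn may have the wrong sign, but the quaternion sum does not see it.
  have h4 : ∀ x, quaternionSum (L x).halfTurn.1 (X x).halfTurn.1 =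
      quaternionSum (L x).halfTurn.1 (axisTurn (A x).1) := by
    intro x
    rcases (hX x).axisTurn_eq_or_neg.2 with h | h <;> rw [h]
    rw [quaternionSum_neg_right]
  have h5 := (hL.quaternionSum h3).congr h4
  exact (h5.inv_sqrt_det_smul h5 fun x => (mat_eq_of_contains (h1 x) (h2 x) (ha x)).1).congr
    fun x => (mat_eq_of_contains (h1 x) (h2 x) (ha x)).2

/-- The scale is positive, so the principal root of −det recovers it exactly and the normal needs no
sign input. -/
lemma isElemMat_normal {P : D → Plane} {V : D → Line} {v : D → H3}
    (hP : IsElemMat φ (fun x => (P x).mat)) (hv : IsElemMat φ (fun x => (v x).mat))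
    (h0 : ∀ x, ((P x).mat * (v x).mat).trace = 0) (h : ∀ x, (P x).IsNormalAt (v x) (V x)) :
    IsElemMat φ (fun x => (V x).halfTurn.1) := by
  have hs : IsElem φ (fun x => ((P x).scale : ℂ)) := hP.det.neg.sqrt.congr fun x => by
    rw [(P x).det_eq_neg_scale_sq, neg_neg, sqrt_sq_of_pos (P x).scale_pos]
  exact (IsElemMat.smul (isElem_I.neg.mul (hs.inv fun x => by
    exact_mod_cast (P x).scale_pos.ne')) (hP.adjugate.mul hv.adjugate)).congr
      fun x => Plane.halfTurn_eq_of_isNormalAt (h0 x) (h x)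

end Elementary

/-! ### The trace formulas -/

/-- A base group with its ortho-end, planes and parameters, together with the auxiliary axes,
base points and normals. -/
structure Config where
  A : SL(2, ℂ)
  B : SL(2, ℂ)
  L : Mark → Line
  P : Mark → Plane
  s : Mark → ℤˣ
  p : Params
  XA : Line
  XB : Line
  v : Mark → H3
  V : Mark → Line
  isSigns : IsSigns A B L s
  liesOn : ∀ k, (L k).LiesOn (P k)
  isAxis_left : IsAxis A XA
  isAxis_right : IsAxis B XB
  contains : ∀ k, (L k).Contains (v k)
  contains_a : XA.Contains (v .a)
  contains_d : XA.Contains (v .d)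
  contains_b : XB.Contains (v .b)
  anti_a : (L .a).halfTurn.1 * XA.halfTurn.1 = -(XA.halfTurn.1 * (L .a).halfTurn.1)
  anti_d : (L .d).halfTurn.1 * XA.halfTurn.1 = -(XA.halfTurn.1 * (L .d).halfTurn.1)
  anti_b : (L .b).halfTurn.1 * XB.halfTurn.1 = -(XB.halfTurn.1 * (L .b).halfTurn.1)
  isNormal : ∀ k, (P k).IsNormalAt (v k) (V k)

namespace Config

/-- The inputs of a configuration. -/
def inputs (x : Config) : Input → ℂ := PlanarNSDC.inputs x.A x.B x.P x.s x.p

/-- The half-turn about the line obtained by the move. -/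
noncomputable def moved (x : Config) (k : Mark) : Matrix (Fin 2) (Fin 2) ℂ :=
  (cosh (x.p.dist k) * cos (x.p.angle k)) • (x.L k).halfTurn.1 +
    (cosh (x.p.dist k) * sin (x.p.angle k)) • ((x.V k).halfTurn.1 * (x.L k).halfTurn.1) +
      (I * sinh (x.p.dist k)) • (x.V k).halfTurn.1

lemma isElemMat_A : IsElemMat inputs (fun x => x.A.1) := fun i j => isElem_var (Input.matA i j)

lemma isElemMat_B : IsElemMat inputs (fun x => x.B.1) := fun i j => isElem_var (Input.matB i j)

lemma isElemMat_P (k : Mark) : IsElemMat inputs (fun x => (x.P k).mat) :=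
  fun i j => isElem_var (Input.plane k i j)

lemma isElem_sign (k : Mark) : IsElem inputs (fun x => ((x.s k : ℤ) : ℂ)) := isElem_var (Input.sign k)

lemma isElemMat_line_d : IsElemMat inputs (fun x => (x.L .d).halfTurn.1) := by
  have hC := (isElemMat_A.mul isElemMat_B).sub (isElemMat_B.mul isElemMat_A)
  exact (IsElemMat.smul (isElem_sign .d)
    (hC.inv_sqrt_det_smul hC fun x => x.isSigns.det_ne)).congr fun x => x.isSigns.perp

lemma sign_mul_self (e : ℤˣ) : ((e : ℤ) : ℂ) * ((e : ℤ) : ℂ) = 1 := by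
  rcases Int.units_eq_one_or e with rfl | rfl <;> simp

lemma eq_neg_sign_smul {M : Matrix (Fin 2) (Fin 2) ℂ} {e : ℤˣ} {X Y : Line}
    (h : M = ((e : ℤ) : ℂ) • (X.halfTurn.1 * Y.halfTurn.1)) :
    X.halfTurn.1 = -(((e : ℤ) : ℂ) • (M * Y.halfTurn.1)) := by
  rw [h, smul_mul_assoc, smul_smul, sign_mul_self, one_smul, mul_assoc, Y.halfTurn_sq]
  simp

lemma isElemMat_line (k : Mark) : IsElemMat inputs (fun x => (x.L k).halfTurn.1) := by
  cases k with
  | d => exact isElemMat_line_d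
  | a =>
    exact (IsElemMat.smul (isElem_sign .a) (isElemMat_A.mul isElemMat_line_d)).neg.congr
      fun x => eq_neg_sign_smul x.isSigns.left
  | b =>
    exact (IsElemMat.smul (isElem_sign .b) (isElemMat_B.mul isElemMat_line_d)).neg.congr
      fun x => eq_neg_sign_smul x.isSigns.right

lemma isElemMat_v (k : Mark) : IsElemMat inputs (fun x => (x.v k).mat) := by
  cases k with
  | d =>
    exact isElemMat_point isElemMat_A (isElemMat_line .d) isAxis_left anti_d
      (fun x => x.contains .d) contains_d
  | a =>
    exact isElemMat_point isElemMat_A (isElemMat_line .a) isAxis_left anti_a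
      (fun x => x.contains .a) contains_a
  | b =>
    exact isElemMat_point isElemMat_B (isElemMat_line .b) isAxis_right anti_b
      (fun x => x.contains .b) contains_b

lemma isElemMat_moved (k : Mark) : IsElemMat inputs (fun x => x.moved k) := by
  have hV := isElemMat_normal (isElemMat_P k) (isElemMat_v k)
    (fun x => (x.liesOn k).trace_eq_zero (x.contains k)) (fun x => x.isNormal k)
  have hd : IsElem inputs (fun x => (x.p.dist k : ℂ)) := isElem_var (Input.dist k)
  have ht : IsElem inputs (fun x => (x.p.angle k : ℂ)) := isElem_var (Input.angle k)
  exact ((IsElemMat.smul (hd.cosh.mul ht.cos) (isElemMat_line k)).add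
    (IsElemMat.smul (hd.cosh.mul ht.sin) (hV.mul (isElemMat_line k)))).add
      (IsElemMat.smul (isElem_I.mul hd.sinh) hV)

lemma isElem_trace_left :
    IsElem inputs (fun x => ((x.s .a : ℤ) : ℂ) * (x.moved .a * x.moved .d).trace) :=
  (isElem_sign .a).mul ((isElemMat_moved .a).mul (isElemMat_moved .d)).trace

lemma isElem_trace_right :
    IsElem inputs (fun x => ((x.s .b : ℤ) : ℂ) * (x.moved .b * x.moved .d).trace) :=
  (isElem_sign .b).mul ((isElemMat_moved .b).mul (isElemMat_moved .d)).trace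

lemma isElem_trace_quotient :
    IsElem inputs (fun x => -(((x.s .a : ℤ) : ℂ) * ((x.s .b : ℤ) : ℂ) *
      (x.moved .a * x.moved .b).trace)) :=
  (((isElem_sign .a).mul (isElem_sign .b)).mul
    ((isElemMat_moved .a).mul (isElemMat_moved .b)).trace).neg

/-- B'⁻¹ is the product of the two half-turns in reverse order; the middle factors in A'B'⁻¹ meet
and square to −1. -/
lemma trace_mul_inv {A' B' : SL(2, ℂ)} {e f : ℤˣ} {X Y Z : Line}
    (hA : A'.1 = ((e : ℤ) : ℂ) • (X.halfTurn.1 * Y.halfTurn.1))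
    (hB : B'.1 = ((f : ℤ) : ℂ) • (Z.halfTurn.1 * Y.halfTurn.1)) :
    (A' * B'⁻¹).1.trace =
      -(((e : ℤ) : ℂ) * ((f : ℤ) : ℂ) * (X.halfTurn.1 * Z.halfTurn.1).trace) := by
  have hinv : (B'⁻¹).1 = ((f : ℤ) : ℂ) • (Y.halfTurn.1 * Z.halfTurn.1) := by
    have h1 : B'.1 * (((f : ℤ) : ℂ) • (Y.halfTurn.1 * Z.halfTurn.1)) = 1 := by
      rw [hB, smul_mul_assoc, mul_smul_comm, smul_smul, sign_mul_self, one_smul, mul_assoc,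
        ← mul_assoc Y.halfTurn.1, Y.halfTurn_sq, neg_one_mul, mul_neg, Z.halfTurn_sq, neg_neg]
    have h2 : (B'⁻¹).1 * B'.1 = 1 := congrArg Subtype.val (inv_mul_cancel B')
    calc (B'⁻¹).1 = (B'⁻¹).1 * (B'.1 * (((f : ℤ) : ℂ) • (Y.halfTurn.1 * Z.halfTurn.1))) := by
          rw [h1, mul_one]
      _ = _ := by rw [← mul_assoc, h2, one_mul]
  have h3 : (A' * B'⁻¹).1 = A'.1 * (B'⁻¹).1 := rfl
  rw [h3, hA, hinv, smul_mul_assoc, mul_smul_comm, smul_smul, mul_assoc,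
    ← mul_assoc Y.halfTurn.1, Y.halfTurn_sq, neg_one_mul, mul_neg, smul_neg, trace_neg, trace_smul,
    smul_eq_mul]

end Config

/-! ### The base points of an ortho-end -/

lemma IsOrthoEnd.exists_points {A B : SL(2, ℂ)} {L : Mark → Line} (h : IsOrthoEnd A B L) :
    ∃ (XA XB : Line) (v : Mark → H3), IsAxis A XA ∧ IsAxis B XB ∧
      (∀ k, (L k).Contains (v k)) ∧ XA.Contains (v .a) ∧ XA.Contains (v .d) ∧
      XB.Contains (v .b) := by
  obtain ⟨⟨XA, XB, hA, hB, hne, h1, h2⟩, hl, hr⟩ := h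
  obtain ⟨va, ha, ha'⟩ := exists_contains (anticommute_axis hA h1 hl)
  obtain ⟨vb, hb, hb'⟩ := exists_contains (anticommute_axis hB h2 hr)
  obtain ⟨vd, hd, hd'⟩ := exists_contains h1.anticommute
  exact ⟨XA, XB, fun | .a => va | .d => vd | .b => vb, hA, hB,
    fun k => by cases k <;> assumption, ha', hd', hb'⟩

/-- The axes used in the moves may be oriented differently from those witnessing the ortho-end. -/
lemma IsAxis.anticommute_of {A : SL(2, ℂ)} {X Y L : Line} (hX : IsAxis A X) (hY : IsAxis A Y)
    (h : L.halfTurn.1 * X.halfTurn.1 = -(X.halfTurn.1 * L.halfTurn.1)) :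
    L.halfTurn.1 * Y.halfTurn.1 = -(Y.halfTurn.1 * L.halfTurn.1) := by
  rcases hX.halfTurn_eq_or_neg hY with e | e <;> rw [e]
  · exact h
  · rw [mul_neg, h, neg_mul]

lemma sameLift_of_sign {A W : SL(2, ℂ)} {e : ℤˣ} (h : A.1 = ((e : ℤ) : ℂ) • W.1)
    (W' : SL(2, ℂ)) : ∃ A', (A' = W' ∨ A' = -W') ∧ SameLift A W A' W' := by
  rcases Int.units_eq_one_or e with rfl | rfl
  · exact ⟨W', Or.inl rfl, Or.inl ⟨Subtype.ext (by simpa using h), rfl⟩⟩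
  · exact ⟨-W', Or.inr rfl, Or.inr ⟨Subtype.ext (by simpa using h), rfl⟩⟩

end PlanarNSDC

/-! ### Assembly of the theorem. -/

open PlanarNSDC in
theorem mainTheorem2 :
    ∃ eA eB eAB : PlanarNSDC.Expr PlanarNSDC.Input,
      ∀ (A B : Matrix.SpecialLinearGroup (Fin 2) ℂ) (L : PlanarNSDC.Mark → PlanarNSDC.Line),
        PlanarNSDC.IsOrthoEnd A B L →
        ∃ s : PlanarNSDC.Mark → ℤˣ,
          ∀ P : PlanarNSDC.Mark → PlanarNSDC.Plane,
            PlanarNSDC.IsNSDC P → (∀ k, (L k).LiesOn (P k)) →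
            (∀ p : PlanarNSDC.Params, p.Admissible →
              ∃ A' B' : Matrix.SpecialLinearGroup (Fin 2) ℂ,
                PlanarNSDC.ObtainedByMoves A B L P p A' B') ∧
            (∀ A' B' : Matrix.SpecialLinearGroup (Fin 2) ℂ, PlanarNSDC.InPlanarFamily P A' B' →
              ∃ p : PlanarNSDC.Params, p.Admissible ∧
                ∃ A₁ B₁ : Matrix.SpecialLinearGroup (Fin 2) ℂ,
                  (A₁ = A' ∨ A₁ = -A') ∧ (B₁ = B' ∨ B₁ = -B') ∧
                  PlanarNSDC.ObtainedByMoves A B L P p A₁ B₁) ∧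
            (∀ (p : PlanarNSDC.Params) (A' B' : Matrix.SpecialLinearGroup (Fin 2) ℂ),
              p.Admissible → PlanarNSDC.ObtainedByMoves A B L P p A' B' →
                PlanarNSDC.InPlanarFamily P A' B' ∧
                eA.Computes (PlanarNSDC.inputs A B P s p) A'.1.trace ∧
                eB.Computes (PlanarNSDC.inputs A B P s p) B'.1.trace ∧
                eAB.Computes (PlanarNSDC.inputs A B P s p) (A' * B'⁻¹).1.trace) := by
  obtain ⟨eA, heA⟩ := Config.isElem_trace_left
  obtain ⟨eB, heB⟩ := Config.isElem_trace_right
  obtain ⟨eAB, heAB⟩ := Config.isElem_trace_quotient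
  refine ⟨eA, eB, eAB, fun A B L hO => ?_⟩
  obtain ⟨s, hs⟩ := hO.exists_isSigns
  refine ⟨s, fun P _ hLP => ⟨fun p _ => ?_, fun A' B' hAB => ?_, fun p A' B' _ hm => ?_⟩⟩
  · obtain ⟨XA, XB, v, hXA, hXB, hv, h1, h2, h3⟩ := hO.exists_points
    choose V hV using fun k => Plane.exists_isNormalAt ((hLP k).trace_eq_zero (hv k))
    choose N hN using fun k => (⟨_, V k, hV k, rfl⟩ : ∃ N, IsMove (P k) (L k) (v k) (p.dist k)
      (p.angle k) N)
    obtain ⟨A', -, hA'⟩ := sameLift_of_sign (W := (L .a).halfTurn * (L .d).halfTurn) hs.left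
      ((N .a).halfTurn * (N .d).halfTurn)
    obtain ⟨B', -, hB'⟩ := sameLift_of_sign (W := (L .b).halfTurn * (L .d).halfTurn) hs.right
      ((N .b).halfTurn * (N .d).halfTurn)
    exact ⟨A', B', XA, XB, v, N, hXA, hXB, hv, h1, h2, h3, hN, hA', hB'⟩
  · obtain ⟨XA, XB, v, hXA, hXB, hv, h1, h2, h3⟩ := hO.exists_points
    obtain ⟨N, hN, hA, hB⟩ := hAB
    choose d τ N' hd hτ hτ' hmove hsgn using
      fun k => exists_isMove (hLP k) (hv k) (hN k)
    obtain ⟨A₁, hA₁, hA₁'⟩ := sameLift_of_sign (W := (L .a).halfTurn * (L .d).halfTurn) hs.left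
      ((N' .a).halfTurn * (N' .d).halfTurn)
    obtain ⟨B₁, hB₁, hB₁'⟩ := sameLift_of_sign (W := (L .b).halfTurn * (L .d).halfTurn) hs.right
      ((N' .b).halfTurn * (N' .d).halfTurn)
    -- The new lines match the prescribed ones up to orientation, which changes the products of
    -- half-turns by signs only.
    have key : ∀ {M M₁ : SL(2, ℂ)} (k : Mark),
        (M = (N k).halfTurn * (N .d).halfTurn ∨ M = -((N k).halfTurn * (N .d).halfTurn)) →
        (M₁ = (N' k).halfTurn * (N' .d).halfTurn ∨ M₁ = -((N' k).halfTurn * (N' .d).halfTurn)) →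
        (M₁ = M ∨ M₁ = -M) := by
      intro M M₁ k h h'
      rcases hsgn k with e | e <;> rcases hsgn .d with f | f <;> rcases h with h | h <;>
        rcases h' with h' | h' <;> simp [h, h', e, f]
    exact ⟨⟨d, τ⟩, fun k => ⟨hd k, hτ k, hτ' k⟩, A₁, B₁, key .a hA hA₁, key .b hB hB₁,
      XA, XB, v, N', hXA, hXB, hv, h1, h2, h3, hmove, hA₁', hB₁'⟩
  · obtain ⟨XA, XB, v, N, hXA, hXB, hv, h1, h2, h3, hN, hA', hB'⟩ := hm
    have hl := hA'.val_eq hs.left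
    have hr := hB'.val_eq hs.right
    obtain ⟨⟨YA, YB, hYA, hYB, -, hp1, hp2⟩, hOl, hOr⟩ := hO
    choose V hV hNV using hN
    -- The universal expressions were obtained over all configurations; the present data form one,
    -- and its inputs do not involve the auxiliary axes, points and normals.
    let x : Config :=
      { A := A, B := B, L := L, P := P, s := s, p := p, XA := XA, XB := XB, v := v, V := V
        isSigns := hs
        liesOn := hLP
        isAxis_left := hXA
        isAxis_right := hXB
        contains := hv
        contains_a := h1
        contains_d := h2
        contains_b := h3
        anti_a := hYA.anticommute_of hXA (anticommute_axis hYA hp1 hOl)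
        anti_d := hYA.anticommute_of hXA hp1.anticommute
        anti_b := hYB.anticommute_of hXB (anticommute_axis hYB hp2 hOr)
        isNormal := hV }
    have hx : ∀ k, (N k).halfTurn.1 = x.moved k := by
      intro k
      rw [hNV k]
      exact halfTurn_move ((hV k).anticommute (hLP k) (hv k)) _ _
    refine ⟨⟨N, fun k => IsMove.liesOn ⟨V k, hV k, hNV k⟩ (hLP k) (hv k), ?_, ?_⟩, ?_, ?_, ?_⟩
    · exact hA'.imp And.right And.right
    · exact hB'.imp And.right And.right
    · have := heA x
      beta_reduce at this
      rw [← hx, ← hx, ← smul_eq_mul, ← trace_smul] at this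
      rw [hl]
      exact this
    · have := heB x
      beta_reduce at this
      rw [← hx, ← hx, ← smul_eq_mul, ← trace_smul] at this
      rw [hr]
      exact this
    · have := heAB x
      beta_reduce at this
      rw [← hx, ← hx] at this
      rw [Config.trace_mul_inv hl hr]
      exact this
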